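/- All graphs are finite, simple and undirected; $+$ denotes disjoint union and $rH$ the disjoint union of $r$ copies of $H$. "$G$ contains $H$" means that $H$ is isomorphic to a (not necessarily induced) subgraph of $G$, and $\Delta(G)$ is the maximum degree. **Edge-subgraph poset.** For a set $E$ of edges of $G$, let $G[E]$ be the graph whose edges are the members of $E$ and whose vertices are the ends of the members of $E$; these are the edge-subgraphs of $G$. For unlabelled graphs (isomorphism classes) $H, G$ write $H\le_e G$ if $H$ is isomorphic to an edge-subgraph of $G$, and let $q(H,G)$ be the number of edge-subgraphs of $G$ that are isomorphic to $H$. Let $Q(G)$ be the set of unlabelled graphs $H\le_e G$ with at least one edge, with the order $\le_e$ and the weight function $q$ restricted to it. Two graphs $G,H$ have the same abstract edge-subgraph poset if there is a bijection $Q(G)\to Q(H)$ that preserves $\le_e$ in both directions and preserves $q$. A graph $G$ is *$Q$-reconstructible* if every graph $H$ with the same abstract edge-subgraph poset as $G$ is isomorphic to $G$ up to isolated vertices. **Special graphs.** $P_n$ and $C_n$ are the path and the cycle on $n$ vertices, and $K_4\setminus e$ is $K_4$ minus an edge. $S_4$ is $K_{1,3}$ with an edge added between two leaves; $T_4$ is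 $K_{1,3}$ with a pendant edge attached to a leaf (so it has 5 vertices and 4 edges). $B_1$ is the tree formed by two adjacent vertices with two further pendant neighbours each; $B_2$ is $C_4$ with a pendant edge attached to each of two adjacent vertices; $B_3$ is $C_4$ with a pendant path of two edges attached to one vertex; $B_4$ is $C_4$ with a pendant edge attached to one vertex. **The family $\mathcal N$.** Let $$\mathcal X=\{P_n: n\ge 2\}\cup\{C_n: n\ge 4\}\cup\{S_4,\,K_4\setminus e,\,K_4\},$$ and let $\mathcal N=\mathcal F_0\cup\mathcal F_1\cup\mathcal F_2\cup\mathcal F_3\cup\mathcal F_4$, where - $\mathcal F_0=\{3K_2, K_3, K_{1,3}\}$, - $\mathcal F_1=\{P_4,\ K_{1,2}+K_2,\ P_4+K_2,\ T_4\}$, - $\mathcal F_2=\{C_4,\ 2K_{1,2},\ C_4+K_2,\ B_1,\ P_6,\ B_2,\ B_3,\ B_4\}$, - $\mathcal F_3=\{K_{1,m}: m>1,\ m\ne 3\}\cup\{mK_2: m>1,\ m\neq 3\}$, - $\mathcal F_4=\{rK_3+sK_{1,3}+F:\ r,s\ge 0,\ r\ne s,\ \text{every component of } F \text{ is in } \mathcal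 X\}\setminus\{K_3,K_{1,3}\}$ ($F$ may be the null graph). **Lemma.** Let $G$ be a graph without isolated vertices. If $G\notin\mathcal N$, $\Delta(G)\le 3$, $G$ contains $K_{1,2}+2K_2$, and $G$ does not contain $T_4$, then $G$ is $Q$-reconstructible. -/

import Mathlib

open scoped SimpleGraph

namespace EdgeSubgraphPoset

/-- The graph `G[E]` induced by a set `E` of edges of a graph on `V`: its vertices are the end
vertices of the members of `E` and its edges are the members of `E`. It is used only for
sets `E` of edges of some simple graph. -/
def edgeInduced {V : Type*} (E : Set (Sym2 V)) : SimpleGraph {v : V // ∃ e ∈ E, v ∈ e} :=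
  (SimpleGraph.fromEdgeSet E).comap Subtype.val

/-- `H` is isomorphic to an edge-subgraph of `G`. -/
def IsEdgeSubgraph {W V : Type*} (H : SimpleGraph W) (G : SimpleGraph V) : Prop :=
  ∃ E : Set (Sym2 V), E ⊆ G.edgeSet ∧ Nonempty (edgeInduced E ≃g H)

/-- The number of edge-subgraphs of `G` that are isomorphic to `H`. -/
noncomputable def edgeSubgraphCount {W V : Type*} (H : SimpleGraph W) (G : SimpleGraph V) : ℤ :=
  ({E : Set (Sym2 V) | E ⊆ G.edgeSet ∧ Nonempty (edgeInduced E ≃g H)}.ncard : ℤ)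

/-- An isomorphism of vertex sets carries `G[E]` to the graph induced by the image of `E`. -/
def edgeInducedIso {V V' : Type*} (φ : V ≃ V') (E : Set (Sym2 V)) :
    edgeInduced E ≃g edgeInduced (Sym2.map φ '' E) where
  toEquiv := φ.subtypeEquiv (by
    intro v
    constructor
    · rintro ⟨e, he, hv⟩
      exact ⟨_, ⟨e, he, rfl⟩, Sym2.mem_map.2 ⟨v, hv, rfl⟩⟩
    · rintro ⟨_, ⟨e, he, rfl⟩, hv⟩
      obtain ⟨w, hw, h⟩ := Sym2.mem_map.1 hv
      exact ⟨e, he, φ.injective h ▸ hw⟩)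
  map_rel_iff' := by
    rintro ⟨a, ha⟩ ⟨b, hb⟩
    have h : s(φ a, φ b) ∈ Sym2.map φ '' E ↔ s(a, b) ∈ E := by
      rw [← Sym2.map_mk, (Sym2.map.injective φ.injective).mem_set_image]
    simp [edgeInduced, h]

theorem image_subset_edgeSet {V V' : Type*} {G : SimpleGraph V} {G' : SimpleGraph V'}
    (φ : G ≃g G') {E : Set (Sym2 V)} (hE : E ⊆ G.edgeSet) :
    Sym2.map φ.toEquiv '' E ⊆ G'.edgeSet := by
  rintro _ ⟨e, he, rfl⟩
  have := hE he
  induction e with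
  | _ a b =>
    rw [SimpleGraph.mem_edgeSet] at this
    exact φ.map_rel_iff.2 this

theorem edgeSubgraphs_image {W V W' V' : Type*} {H : SimpleGraph W} {G : SimpleGraph V}
    {H' : SimpleGraph W'} {G' : SimpleGraph V'} (ψ : H ≃g H') (φ : G ≃g G')
    {E : Set (Sym2 V)} (hE : E ⊆ G.edgeSet ∧ Nonempty (edgeInduced E ≃g H)) :
    Sym2.map φ.toEquiv '' E ⊆ G'.edgeSet ∧
      Nonempty (edgeInduced (Sym2.map φ.toEquiv '' E) ≃g H') := by
  obtain ⟨h, ⟨θ⟩⟩ := hE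
  exact ⟨image_subset_edgeSet φ h, ⟨(edgeInducedIso φ.toEquiv E).symm.trans (θ.trans ψ)⟩⟩

theorem isEdgeSubgraph_congr {W V W' V' : Type*} {H : SimpleGraph W} {G : SimpleGraph V}
    {H' : SimpleGraph W'} {G' : SimpleGraph V'} (ψ : H ≃g H') (φ : G ≃g G') :
    IsEdgeSubgraph H G ↔ IsEdgeSubgraph H' G' :=
  ⟨fun ⟨_, hE⟩ => ⟨_, edgeSubgraphs_image ψ φ hE⟩,
    fun ⟨_, hE⟩ => ⟨_, edgeSubgraphs_image ψ.symm φ.symm hE⟩⟩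

theorem edgeSubgraphCount_congr {W V W' V' : Type*} {H : SimpleGraph W} {G : SimpleGraph V}
    {H' : SimpleGraph W'} {G' : SimpleGraph V'} (ψ : H ≃g H') (φ : G ≃g G') :
    edgeSubgraphCount H G = edgeSubgraphCount H' G' := by
  unfold edgeSubgraphCount
  congr 1
  refine Set.ncard_congr (fun E _ => Sym2.map φ.toEquiv '' E)
    (fun E hE => edgeSubgraphs_image ψ φ hE) ?_ ?_
  · intro A B _ _ h
    exact (Sym2.map.injective φ.toEquiv.injective).image_injective h
  · intro E hE
    refine ⟨_, edgeSubgraphs_image ψ.symm φ.symm hE, ?_⟩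
    rw [← Set.image_comp, ← Sym2.map_comp]
    have : (φ.toEquiv ∘ φ.symm.toEquiv : V' → V') = id := by
      funext x
      exact φ.toEquiv.apply_symm_apply x
    rw [this, Sym2.map_id, Set.image_id]

/-- Isomorphism of finite simple graphs, on representatives with vertex set `Fin n`. -/
instance graphSetoid : Setoid (Σ n : ℕ, SimpleGraph (Fin n)) where
  r A B := Nonempty (A.2 ≃g B.2)
  iseqv :=
    { refl := fun _ => ⟨SimpleGraph.Iso.refl⟩
      symm := fun ⟨φ⟩ => ⟨φ.symm⟩
      trans := fun ⟨φ⟩ ⟨ψ⟩ => ⟨φ.trans ψ⟩ }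

/-- The set of all unlabelled finite simple graphs, that is, of isomorphism classes. -/
def UnlabelledGraph : Type := Quotient graphSetoid

/-- The isomorphism class of a finite graph. -/
noncomputable def unlabelled {V : Type*} [Finite V] (G : SimpleGraph V) : UnlabelledGraph :=
  Quotient.mk graphSetoid ⟨Nat.card V, G.map (Finite.equivFin V).toEmbedding⟩

theorem unlabelled_eq_iff {V W : Type*} [Finite V] [Finite W] (G : SimpleGraph V)
    (H : SimpleGraph W) : unlabelled G = unlabelled H ↔ Nonempty (G ≃g H) := by
  have φ := SimpleGraph.Iso.map (Finite.equivFin V) G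
  have ψ := SimpleGraph.Iso.map (Finite.equivFin W) H
  refine Quotient.eq.trans ⟨?_, ?_⟩
  · rintro ⟨θ⟩
    exact ⟨(φ.trans θ).trans ψ.symm⟩
  · rintro ⟨θ⟩
    exact ⟨(φ.symm.trans θ).trans ψ⟩

namespace UnlabelledGraph

/-- `H ≤ₑ G`: the graph `H` is isomorphic to an edge-subgraph of `G`. -/
def EdgeLE (H G : UnlabelledGraph) : Prop :=
  Quotient.liftOn₂ H G (fun A B => IsEdgeSubgraph A.2 B.2)
    (fun _ _ _ _ ⟨φ⟩ ⟨ψ⟩ => propext (isEdgeSubgraph_congr φ ψ))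

/-- The weight `q(H, G)`: the number of edge-subgraphs of `G` isomorphic to `H`. -/
noncomputable def q (H G : UnlabelledGraph) : ℤ :=
  Quotient.liftOn₂ H G (fun A B => edgeSubgraphCount A.2 B.2)
    (fun _ _ _ _ ⟨φ⟩ ⟨ψ⟩ => edgeSubgraphCount_congr φ ψ)

/-- The number of edges `e(G)`. -/
noncomputable def numEdges (G : UnlabelledGraph) : ℕ :=
  Quotient.liftOn G (fun A => A.2.edgeSet.ncard)
    (fun _ _ ⟨φ⟩ => Nat.card_congr φ.mapEdgeSet)

/-- The underlying set `Q(G)` of the concrete edge-subgraph poset of `G`; the order is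
`EdgeLE` and the weight function is `q`. -/
def Q (G : UnlabelledGraph) : Set UnlabelledGraph :=
  {H | EdgeLE H G ∧ 0 < numEdges H}

/-- The weighted posets `Q(G)` and `Q(H)` are isomorphic, that is, `G` and `H` have the same
abstract edge-subgraph poset. -/
def SameEdgeSubgraphPoset (G H : UnlabelledGraph) : Prop :=
  ∃ f : Q G ≃ Q H, ∀ x y : Q G,
    (EdgeLE x.1 y.1 ↔ EdgeLE (f x).1 (f y).1) ∧ q x.1 y.1 = q (f x).1 (f y).1

end UnlabelledGraph

/-- `G` is `Q`-reconstructible: every finite graph with the same abstract edge-subgraph poset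
as `G` is isomorphic to `G` up to isolated vertices. -/
def QReconstructible {V : Type*} [Finite V] (G : SimpleGraph V) : Prop :=
  ∀ (W : Type) [Finite W] (H : SimpleGraph W),
    UnlabelledGraph.SameEdgeSubgraphPoset (unlabelled G) (unlabelled H) →
      Nonempty (G.induce G.support ≃g H.induce H.support)

/-- The disjoint union `rH` of `r` copies of `H`. -/
abbrev copies (r : ℕ) {W : Type*} (H : SimpleGraph W) : SimpleGraph (Fin r × W) :=
  (⊥ : SimpleGraph (Fin r)) □ H

/-- The path `P_n` on `n` vertices. -/
abbrev P (n : ℕ) : SimpleGraph (Fin n) := SimpleGraph.pathGraph n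

/-- The cycle `C_n` on `n` vertices (used for `n ≥ 3` only). -/
abbrev C (n : ℕ) : SimpleGraph (Fin n) := SimpleGraph.cycleGraph n

/-- The complete graph `K_n`. -/
abbrev K (n : ℕ) : SimpleGraph (Fin n) := SimpleGraph.completeGraph (Fin n)

/-- The star `K_{1,m}`. -/
abbrev Star (m : ℕ) : SimpleGraph (Fin 1 ⊕ Fin m) := completeBipartiteGraph (Fin 1) (Fin m)

/-- `K_4` minus an edge. -/
def K4e : SimpleGraph (Fin 4) := (K 4).deleteEdges {s(0, 1)}

/-- `S_4`: the star `K_{1,3}` with an edge added between two of its leaves. -/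
def S4 : SimpleGraph (Fin 4) := SimpleGraph.fromEdgeSet {s(0, 1), s(0, 2), s(0, 3), s(1, 2)}

/-- `T_4`: the star `K_{1,3}` with a pendant edge attached to one of its leaves. -/
def T4 : SimpleGraph (Fin 5) := SimpleGraph.fromEdgeSet {s(0, 1), s(0, 2), s(0, 3), s(3, 4)}

/-- `B_1`: two adjacent vertices, each with two further pendant neighbours. -/
def B1 : SimpleGraph (Fin 6) :=
  SimpleGraph.fromEdgeSet {s(0, 1), s(0, 2), s(0, 3), s(1, 4), s(1, 5)}

/-- `B_2`: a 4-cycle with a pendant edge attached to each of two adjacent vertices. -/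
def B2 : SimpleGraph (Fin 6) :=
  SimpleGraph.fromEdgeSet {s(0, 1), s(1, 2), s(2, 3), s(3, 0), s(0, 4), s(1, 5)}

/-- `B_3`: a 4-cycle with a pendant path with two edges attached to one vertex. -/
def B3 : SimpleGraph (Fin 6) :=
  SimpleGraph.fromEdgeSet {s(0, 1), s(1, 2), s(2, 3), s(3, 0), s(0, 4), s(4, 5)}

/-- `B_4`: a 4-cycle with a pendant edge attached to one vertex. -/
def B4 : SimpleGraph (Fin 5) :=
  SimpleGraph.fromEdgeSet {s(0, 1), s(1, 2), s(2, 3), s(3, 0), s(0, 4)}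

noncomputable section

def F0 : Set UnlabelledGraph :=
  {unlabelled (copies 3 (K 2)), unlabelled (K 3), unlabelled (Star 3)}

def F1 : Set UnlabelledGraph :=
  {unlabelled (P 4), unlabelled (Star 2 ⊕g K 2), unlabelled (P 4 ⊕g K 2), unlabelled T4}

def F2 : Set UnlabelledGraph :=
  {unlabelled (C 4), unlabelled (copies 2 (Star 2)), unlabelled (C 4 ⊕g K 2), unlabelled B1,
    unlabelled (P 6), unlabelled B2, unlabelled B3, unlabelled B4}

def F3 : Set UnlabelledGraph :=
  {x | ∃ m : ℕ, 1 < m ∧ m ≠ 3 ∧ x = unlabelled (Star m)} ∪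
    {x | ∃ m : ℕ, 1 < m ∧ m ≠ 3 ∧ x = unlabelled (copies m (K 2))}

/-- The set `𝒳` of connected graphs. -/
def X : Set UnlabelledGraph :=
  {x | ∃ n : ℕ, 2 ≤ n ∧ x = unlabelled (P n)} ∪ {x | ∃ n : ℕ, 4 ≤ n ∧ x = unlabelled (C n)} ∪
    {unlabelled S4, unlabelled K4e, unlabelled (K 4)}

/-- All components of `F` are isomorphic to members of `𝒳` (the null graph is allowed). -/
def ComponentsInX {n : ℕ} (F : SimpleGraph (Fin n)) : Prop :=
  ∀ c : F.ConnectedComponent, unlabelled c.toSimpleGraph ∈ X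

def F4 : Set UnlabelledGraph :=
  {x | ∃ r s : ℕ, r ≠ s ∧ ∃ (n : ℕ) (F : SimpleGraph (Fin n)), ComponentsInX F ∧
    x = unlabelled (copies r (K 3) ⊕g copies s (Star 3) ⊕g F)} \
    {unlabelled (K 3), unlabelled (Star 3)}

/-- The family `𝒩` of exceptional graphs. -/
def N : Set UnlabelledGraph := F0 ∪ F1 ∪ F2 ∪ F3 ∪ F4

end

end EdgeSubgraphPoset

/-!
Call a graph thin if it contains neither `T_4` nor `K_{1,4}`. A connected thin graph with a vertex
of degree three has only four vertices, since a neighbour of a neighbour of that vertex outside its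
closed neighbourhood would give a `T_4`; otherwise it is a path or a cycle
(`exists_iso_of_isThin`). So a thin graph `G` without isolated vertices has the form
`r K_3 + s K_{1,3} + F` with all components of `F` in `𝒳`. Members of `𝒳` have as many triangles
as claws, hence `G ∉ ℱ₄` says that `r = s`, that is, `K_3` and `K_{1,3}` occur equally often as
subgraphs of `G` (`edgeSubgraphCount_K3_sub_star`).

Two general facts reduce the theorem to connected subgraphs. A copy of a connected graph lies in
one component, and a graph does not occur in a component with fewer edges, so the numbers of copies
of all connected graphs determine the components, and therefore the graph
(`iso_of_edgeSubgraphCount_connected`). Moreover, connectedness can be read off from the poset and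
the number of pairs of adjacent edges: a connected graph with at least two edges arises from a
connected graph with one edge less by adding an edge that creates a new pair of adjacent edges, and
conversely adding such an edge to a connected graph keeps it connected
(`exists_connected_isEdgeSubgraph`, `connected_of_isEdgeSubgraph`).

Let `f : Q(G) → Q(H)` be an isomorphism of weighted posets. It fixes the least element `K_2`, whose
weights are the numbers of edges. As `G` contains `K_{1,2} + 2K_2`, it also fixes `K_{1,2}`
(`IsWeightedIso.star_two_eq`), whose weights are the numbers of pairs of adjacent edges. So `f`
preserves connectedness, and `H` is thin because preimages of `T_4` and `K_{1,4}` would have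
impossible parameters (`IsStrongIso.thin`). The numbers of edges and of pairs of adjacent edges
separate the connected thin graphs except for `K_3` and `K_{1,3}` (`iso_of_isThin_of_eq`), so `f`
fixes every connected graph up to this confusion. The confusion is harmless, because `K_3` and
`K_{1,3}` occur equally often in `G`; hence all connected graphs occur equally often in `G` and
`H` (`IsStrongIso.q_eq`).
-/

namespace EdgeSubgraphPoset

/-! ### Edge-induced subgraphs and their counts -/

/-- Every vertex has a neighbour. -/
def NoIsolated {V : Type*} (G : SimpleGraph V) : Prop := ∀ v, ∃ w, G.Adj v w

/-- The subsets of `S` that induce a copy of `T`. -/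
def copiesIn {W V : Type*} (T : SimpleGraph W) (S : Set (Sym2 V)) : Set (Set (Sym2 V)) :=
  {E | E ⊆ S ∧ Nonempty (edgeInduced E ≃g T)}

section Basic

variable {V V' W W' : Type*}

theorem edgeSubgraphCount_eq_ncard (T : SimpleGraph W) (G : SimpleGraph V) :
    edgeSubgraphCount T G = ((copiesIn T G.edgeSet).ncard : ℤ) := rfl

theorem edgeInduced_adj {E : Set (Sym2 V)} {a b : {v : V // ∃ e ∈ E, v ∈ e}} :
    (edgeInduced E).Adj a b ↔ s(a.1, b.1) ∈ E ∧ a.1 ≠ b.1 := by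
  simp [edgeInduced]

/-- An injective map carries `G[E]` to the graph induced by the image of `E`. -/
noncomputable def edgeInducedImageIso {φ : V → V'} (hφ : Function.Injective φ)
    (E : Set (Sym2 V)) : edgeInduced E ≃g edgeInduced (Sym2.map φ '' E) where
  toEquiv := Equiv.ofBijective
    (fun v => ⟨φ v.1, by
      obtain ⟨v, e, he, hv⟩ := v
      exact ⟨_, ⟨e, he, rfl⟩, Sym2.mem_map.2 ⟨v, hv, rfl⟩⟩⟩) (by
    constructor
    · intro a b h
      exact Subtype.ext (hφ (Subtype.ext_iff.1 h))
    · rintro ⟨_, _, ⟨e, he, rfl⟩, hv⟩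
      obtain ⟨w, hw, rfl⟩ := Sym2.mem_map.1 hv
      exact ⟨⟨w, e, he, hw⟩, rfl⟩)
  map_rel_iff' := by
    rintro ⟨a, ha⟩ ⟨b, hb⟩
    have h : s(φ a, φ b) ∈ Sym2.map φ '' E ↔ s(a, b) ∈ E := by
      rw [← Sym2.map_mk, (Sym2.map.injective hφ).mem_set_image]
    rw [edgeInduced_adj, edgeInduced_adj]
    exact h.and (not_congr hφ.eq_iff)

/-- A graph without isolated vertices is induced by its edges. -/
noncomputable def edgeInducedEdgeSetIso {G : SimpleGraph V} (hG : NoIsolated G) :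
    edgeInduced G.edgeSet ≃g G where
  toEquiv := Equiv.subtypeUnivEquiv (fun v => by
    obtain ⟨w, hw⟩ := hG v
    exact ⟨s(v, w), hw, by simp⟩)
  map_rel_iff' := by
    rintro ⟨a, ha⟩ ⟨b, hb⟩
    simp only [Equiv.subtypeUnivEquiv_apply, edgeInduced_adj, SimpleGraph.mem_edgeSet]
    exact ⟨fun h => ⟨h, h.ne⟩, fun h => h.1⟩

theorem noIsolated_edgeInduced {G : SimpleGraph V} {E : Set (Sym2 V)} (hE : E ⊆ G.edgeSet) :
    NoIsolated (edgeInduced E) := by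
  rintro ⟨v, e, he, hv⟩
  obtain ⟨w, rfl⟩ := Sym2.mem_iff_exists.1 hv
  exact ⟨⟨w, _, he, by simp⟩, edgeInduced_adj.2 ⟨he, (hE he).ne⟩⟩

theorem NoIsolated.congr {G : SimpleGraph V} {H : SimpleGraph W} (φ : G ≃g H)
    (hG : NoIsolated G) : NoIsolated H := by
  intro v
  obtain ⟨w, hw⟩ := hG (φ.symm v)
  exact ⟨φ w, by simpa using φ.map_rel_iff.2 hw⟩

theorem map_val_edgeSet_edgeInduced {G : SimpleGraph V} {E : Set (Sym2 V)}
    (hE : E ⊆ G.edgeSet) : Sym2.map Subtype.val '' (edgeInduced E).edgeSet = E := by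
  ext e
  constructor
  · rintro ⟨e, he, rfl⟩
    induction e with
    | _ a b => exact (edgeInduced_adj.1 he).1
  · intro he
    induction e with
    | _ a b =>
      exact ⟨s(⟨a, _, he, by simp⟩, ⟨b, _, he, by simp⟩),
        edgeInduced_adj.2 ⟨he, (hE he).ne⟩, rfl⟩

theorem copiesIn_image {φ : V → V'} (hφ : Function.Injective φ) (T : SimpleGraph W)
    (S : Set (Sym2 V)) :
    copiesIn T (Sym2.map φ '' S) = (fun E => Sym2.map φ '' E) '' copiesIn T S := by
  ext E
  constructor
  · rintro ⟨h, ⟨θ⟩⟩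
    obtain ⟨E, hE, rfl⟩ := Set.subset_image_iff.1 h
    exact ⟨E, ⟨hE, ⟨(edgeInducedImageIso hφ E).trans θ⟩⟩, rfl⟩
  · rintro ⟨E, ⟨hE, ⟨θ⟩⟩, rfl⟩
    exact ⟨Set.image_mono hE, ⟨(edgeInducedImageIso hφ E).symm.trans θ⟩⟩

theorem ncard_copiesIn_image {φ : V → V'} (hφ : Function.Injective φ) (T : SimpleGraph W)
    (S : Set (Sym2 V)) : (copiesIn T (Sym2.map φ '' S)).ncard = (copiesIn T S).ncard := by
  rw [copiesIn_image hφ, Set.ncard_image_of_injective _ (Sym2.map.injective hφ).image_injective]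

theorem edgeSubgraphCount_edgeInduced {G : SimpleGraph V} {E : Set (Sym2 V)}
    (hE : E ⊆ G.edgeSet) (T : SimpleGraph W) :
    edgeSubgraphCount T (edgeInduced E) = ((copiesIn T E).ncard : ℤ) := by
  rw [edgeSubgraphCount_eq_ncard, ← ncard_copiesIn_image Subtype.val_injective,
    map_val_edgeSet_edgeInduced hE]

theorem ncard_edgeSet_edgeInduced {G : SimpleGraph V} {E : Set (Sym2 V)}
    (hE : E ⊆ G.edgeSet) : (edgeInduced E).edgeSet.ncard = E.ncard := by
  rw [← Set.ncard_image_of_injective _ (Sym2.map.injective Subtype.val_injective),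
    map_val_edgeSet_edgeInduced hE]

theorem ncard_edgeSet_congr {G : SimpleGraph V} {H : SimpleGraph W} (φ : G ≃g H) :
    G.edgeSet.ncard = H.edgeSet.ncard := Nat.card_congr φ.mapEdgeSet

theorem isEdgeSubgraph_iff {T : SimpleGraph W} {G : SimpleGraph V} :
    IsEdgeSubgraph T G ↔ NoIsolated T ∧ T.IsContained G := by
  constructor
  · rintro ⟨E, hE, ⟨θ⟩⟩
    refine ⟨(noIsolated_edgeInduced hE).congr θ, ?_⟩
    refine (SimpleGraph.isContained_congr_left θ).1 ⟨⟨⟨Subtype.val, ?_⟩, Subtype.val_injective⟩⟩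
    intro a b h
    exact hE (edgeInduced_adj.1 h).1
  · rintro ⟨hT, ⟨φ⟩⟩
    refine ⟨Sym2.map φ '' T.edgeSet, ?_,
      ⟨(edgeInducedImageIso φ.injective _).symm.trans (edgeInducedEdgeSetIso hT)⟩⟩
    rintro _ ⟨e, he, rfl⟩
    induction e with
    | _ a b => exact φ.toHom.map_rel he

theorem edgeSubgraphCount_ne_zero_iff [Finite V] {T : SimpleGraph W} {G : SimpleGraph V} :
    edgeSubgraphCount T G ≠ 0 ↔ IsEdgeSubgraph T G := by
  rw [edgeSubgraphCount_eq_ncard, Nat.cast_ne_zero, ← Nat.pos_iff_ne_zero, Set.ncard_pos]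
  rfl

theorem edgeSubgraphCount_eq_zero_iff [Finite V] {T : SimpleGraph W} {G : SimpleGraph V} :
    edgeSubgraphCount T G = 0 ↔ ¬ IsEdgeSubgraph T G := by
  rw [← edgeSubgraphCount_ne_zero_iff, not_not]

theorem IsEdgeSubgraph.ncard_edgeSet_le [Finite V] {T : SimpleGraph W} {G : SimpleGraph V}
    (h : IsEdgeSubgraph T G) : T.edgeSet.ncard ≤ G.edgeSet.ncard := by
  obtain ⟨E, hE, ⟨θ⟩⟩ := h
  rw [← ncard_edgeSet_congr θ, ncard_edgeSet_edgeInduced hE]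
  exact Set.ncard_le_ncard hE (Set.toFinite _)

theorem IsEdgeSubgraph.trans {T : SimpleGraph W} {G : SimpleGraph V} {H : SimpleGraph V'}
    (h : IsEdgeSubgraph T G) (h' : IsEdgeSubgraph G H) : IsEdgeSubgraph T H := by
  rw [isEdgeSubgraph_iff] at *
  exact ⟨h.1, h.2.trans h'.2⟩

theorem IsEdgeSubgraph.iso_of_ncard_le [Finite V] {T : SimpleGraph W} {G : SimpleGraph V}
    (h : IsEdgeSubgraph T G) (hG : NoIsolated G) (hc : G.edgeSet.ncard ≤ T.edgeSet.ncard) :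
    Nonempty (T ≃g G) := by
  obtain ⟨E, hE, ⟨θ⟩⟩ := h
  rw [← ncard_edgeSet_congr θ, ncard_edgeSet_edgeInduced hE] at hc
  obtain rfl := Set.eq_of_subset_of_ncard_le hE hc (Set.toFinite _)
  exact ⟨θ.symm.trans (edgeInducedEdgeSetIso hG)⟩

theorem edgeSubgraphCount_self [Finite V] {T : SimpleGraph W} {G : SimpleGraph V}
    (hG : NoIsolated G) (φ : G ≃g T) : edgeSubgraphCount T G = 1 := by
  have : copiesIn T G.edgeSet = {G.edgeSet} := by
    ext E
    simp only [Set.mem_singleton_iff]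
    constructor
    · rintro ⟨hE, ⟨θ⟩⟩
      refine Set.eq_of_subset_of_ncard_le hE ?_ (Set.toFinite _)
      rw [← ncard_edgeSet_edgeInduced hE, ncard_edgeSet_congr θ, ncard_edgeSet_congr φ]
    · rintro rfl
      exact ⟨le_rfl, ⟨(edgeInducedEdgeSetIso hG).trans φ⟩⟩
  rw [edgeSubgraphCount_eq_ncard, this]
  simp

/-- A connected graph with an edge has no isolated vertex. -/
theorem noIsolated_of_connected {G : SimpleGraph V} (hG : G.Connected)
    (he : G.edgeSet.Nonempty) : NoIsolated G := by
  obtain ⟨e, he⟩ := he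
  have : Nontrivial V := by
    induction e with
    | _ a b => exact ⟨a, b, SimpleGraph.Adj.ne he⟩
  exact fun v => hG.preconnected.exists_adj_of_nontrivial v

/-- Up to isomorphism, a graph with one edge and no isolated vertex is `K_2`. -/
theorem iso_K2_of_ncard_eq_one {G : SimpleGraph V} (hG : NoIsolated G)
    (h : G.edgeSet.ncard = 1) : Nonempty (G ≃g K 2) := by
  obtain ⟨e, he⟩ := Set.ncard_eq_one.1 h
  have h1 : e ∈ G.edgeSet := by rw [he]; rfl
  induction e with
  | _ a b =>
    have hab : G.Adj a b := h1
    have key : ∀ x y, G.Adj x y → (x = a ∧ y = b) ∨ (x = b ∧ y = a) := by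
      intro x y hxy
      have : s(x, y) ∈ G.edgeSet := hxy
      rw [he] at this
      simpa using this
    have hv : ∀ v, v = a ∨ v = b := by
      intro v
      obtain ⟨w, hw⟩ := hG v
      rcases key v w hw with h | h <;> simp [h.1]
    let f : Fin 2 → V := ![a, b]
    have hf : Function.Bijective f := by
      constructor
      · intro i j
        fin_cases i <;> fin_cases j <;> simp [f, hab.ne, hab.ne']
      · intro v
        rcases hv v with rfl | rfl
        · exact ⟨0, rfl⟩
        · exact ⟨1, rfl⟩
    refine ⟨SimpleGraph.Iso.symm ⟨Equiv.ofBijective f hf, ?_⟩⟩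
    intro i j
    fin_cases i <;> fin_cases j <;> simp [f, hab, hab.symm]

theorem ncard_edgeSet_K2 : (K 2).edgeSet.ncard = 1 := by
  rw [Set.ncard_eq_toFinset_card']; decide

theorem edgeSubgraphCount_K2 [Finite V] (G : SimpleGraph V) :
    edgeSubgraphCount (K 2) G = (G.edgeSet.ncard : ℤ) := by
  rw [edgeSubgraphCount_eq_ncard]
  have : copiesIn (K 2) G.edgeSet = (fun e => {e}) '' G.edgeSet := by
    ext E
    constructor
    · rintro ⟨hE, ⟨θ⟩⟩
      have h := ncard_edgeSet_congr θ
      rw [ncard_edgeSet_edgeInduced hE, ncard_edgeSet_K2] at h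
      obtain ⟨e, rfl⟩ := Set.ncard_eq_one.1 h
      exact ⟨e, hE rfl, rfl⟩
    · rintro ⟨e, he, rfl⟩
      have hE : {e} ⊆ G.edgeSet := by simpa using he
      refine ⟨hE, iso_K2_of_ncard_eq_one (noIsolated_edgeInduced hE) ?_⟩
      rw [ncard_edgeSet_edgeInduced hE]
      simp
  rw [this, Set.ncard_image_of_injective _ Set.singleton_injective]

end Basic

/-! ### Counting stars and complete subgraphs -/

section Counting

variable {V W : Type*}

theorem mem_copiesIn_iff_exists_copy {T : SimpleGraph W} {G : SimpleGraph V} (hT : NoIsolated T)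
    {E : Set (Sym2 V)} :
    E ∈ copiesIn T G.edgeSet ↔ ∃ φ : SimpleGraph.Copy T G, Sym2.map φ '' T.edgeSet = E := by
  constructor
  · rintro ⟨hE, ⟨θ⟩⟩
    refine ⟨⟨⟨fun w => (θ.symm w).1, ?_⟩, ?_⟩, ?_⟩
    · intro a b h
      exact hE (edgeInduced_adj.1 (θ.symm.map_rel_iff.2 h)).1
    · intro a b h
      exact θ.symm.injective (Subtype.ext h)
    · refine Eq.trans ?_ (map_val_edgeSet_edgeInduced hE)
      ext e
      constructor
      · rintro ⟨e, he, rfl⟩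
        induction e with
        | _ a b =>
          exact ⟨s(θ.symm a, θ.symm b), θ.symm.map_rel_iff.2 he, rfl⟩
      · rintro ⟨e, he, rfl⟩
        induction e with
        | _ a b =>
          refine ⟨s(θ a, θ b), θ.map_rel_iff.2 he, ?_⟩
          change s((θ.symm (θ a)).1, (θ.symm (θ b)).1) = s(a.1, b.1)
          rw [θ.symm_apply_apply, θ.symm_apply_apply]
  · rintro ⟨φ, rfl⟩
    refine ⟨?_, ⟨(edgeInducedImageIso φ.injective _).symm.trans (edgeInducedEdgeSetIso hT)⟩⟩
    rintro _ ⟨e, he, rfl⟩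
    induction e with
    | _ a b => exact φ.toHom.map_rel he

theorem noIsolated_star {m : ℕ} (hm : m ≠ 0) : NoIsolated (Star m) := by
  have : NeZero m := ⟨hm⟩
  rintro (i | i)
  · exact ⟨Sum.inr 0, by simp⟩
  · exact ⟨Sum.inl 0, by simp⟩

theorem map_edgeSet_star {m : ℕ} (φ : Fin 1 ⊕ Fin m → V) :
    Sym2.map φ '' (Star m).edgeSet =
      (fun w => s(φ (Sum.inl 0), w)) '' Set.range (φ ∘ Sum.inr) := by
  ext e
  constructor
  · rintro ⟨e, he, rfl⟩
    induction e with
    | _ a b =>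
      rcases a with a | a <;> rcases b with b | b
      · simp at he
      · obtain rfl := Subsingleton.elim a 0
        exact ⟨_, ⟨b, rfl⟩, rfl⟩
      · obtain rfl := Subsingleton.elim b 0
        exact ⟨_, ⟨a, rfl⟩, Sym2.eq_swap⟩
      · simp at he
  · rintro ⟨_, ⟨i, rfl⟩, rfl⟩
    exact ⟨s(Sum.inl 0, Sum.inr i), by simp, rfl⟩

theorem copiesIn_star [Fintype V] [DecidableEq V] (G : SimpleGraph V) [DecidableRel G.Adj]
    {m : ℕ} (hm : m ≠ 0) :
    copiesIn (Star m) G.edgeSet =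
      (fun p : (_ : V) × Finset V => (fun w => s(p.1, w)) '' (p.2 : Set V)) ''
        ((Finset.univ : Finset V).sigma fun v => (G.neighborFinset v).powersetCard m :) := by
  ext E
  rw [mem_copiesIn_iff_exists_copy (noIsolated_star hm)]
  constructor
  · rintro ⟨φ, rfl⟩
    have hinj : Function.Injective (fun i => φ (Sum.inr i)) :=
      φ.injective.comp Sum.inr_injective
    refine ⟨⟨φ (Sum.inl 0), Finset.univ.map ⟨_, hinj⟩⟩, ?_, ?_⟩
    · simp only [Finset.coe_sigma, Set.mem_sigma_iff, Finset.coe_univ, Set.mem_univ, true_and,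
        Finset.mem_coe, Finset.mem_powersetCard, Finset.card_map, Finset.card_univ,
        Fintype.card_fin, and_true]
      intro w hw
      obtain ⟨i, _, rfl⟩ := Finset.mem_map.1 hw
      rw [SimpleGraph.mem_neighborFinset]
      exact φ.toHom.map_rel (by simp)
    · rw [map_edgeSet_star]
      simp [Function.comp_def]
  · rintro ⟨⟨v, A⟩, hA, rfl⟩
    simp only [Finset.coe_sigma, Set.mem_sigma_iff, Finset.coe_univ, Set.mem_univ, true_and,
      Finset.mem_coe, Finset.mem_powersetCard] at hA
    let ψ : Fin m ≃ A := (Finset.equivFinOfCardEq hA.2).symm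
    have hadj : ∀ i, G.Adj v (ψ i).1 := fun i => by
      have := hA.1 (ψ i).2
      simpa using this
    refine ⟨⟨⟨Sum.elim (fun _ => v) (fun i => (ψ i).1), ?_⟩, ?_⟩, ?_⟩
    · rintro (a | a) (b | b) h
      · simp at h
      · exact hadj b
      · exact (hadj a).symm
      · simp at h
    · rintro (a | a) (b | b) h
      · rw [Subsingleton.elim a b]
      · exact absurd h (hadj b).ne
      · exact absurd h (hadj a).ne'
      · exact congrArg Sum.inr (ψ.injective (Subtype.ext h))
    · refine (map_edgeSet_star _).trans ?_
      congr 1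
      ext w
      constructor
      · rintro ⟨i, rfl⟩
        exact (ψ i).2
      · intro hw
        refine ⟨ψ.symm ⟨w, hw⟩, ?_⟩
        change (ψ (ψ.symm ⟨w, hw⟩)).1 = w
        rw [ψ.apply_symm_apply]

/-- The number of stars `K_{1,m}`, `m ≥ 2`, in terms of the degrees; the centre of such a star
is determined by its edge set. -/
theorem edgeSubgraphCount_star [Fintype V] [DecidableEq V] (G : SimpleGraph V)
    [DecidableRel G.Adj] {m : ℕ} (hm : 2 ≤ m) :
    edgeSubgraphCount (Star m) G = ((∑ v, (G.degree v).choose m : ℕ) : ℤ) := by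
  rw [edgeSubgraphCount_eq_ncard, copiesIn_star G (by omega), Set.InjOn.ncard_image,
    Set.ncard_coe_finset, Finset.card_sigma]
  · simp
  · rintro ⟨v, A⟩ hA ⟨w, B⟩ hB h
    simp only [Finset.coe_sigma, Set.mem_sigma_iff, Finset.coe_univ, Set.mem_univ, true_and,
      Finset.mem_coe, Finset.mem_powersetCard] at hA hB h
    obtain ⟨x, hx, y, hy, hxy⟩ := Finset.one_lt_card.1 (show 1 < A.card by omega)
    have key : ∀ z ∈ A, w = v ∨ w = z := by
      intro z hz
      have : s(v, z) ∈ (fun u => s(w, u)) '' (B : Set V) := h ▸ ⟨z, hz, rfl⟩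
      obtain ⟨u, _, hu⟩ := this
      have : w ∈ s(v, z) := hu ▸ Sym2.mem_mk_left w u
      simpa using this
    have hwv : w = v := by
      rcases key x hx with h1 | h1
      · exact h1
      · rcases key y hy with h2 | h2
        · exact h2
        · exact absurd (h1.symm.trans h2) hxy
    subst hwv
    have : (A : Set V) = B := by
      refine Set.image_injective.2 ?_ h
      intro a b hab
      exact Sym2.congr_right.1 hab
    rw [Finset.coe_injective this]

theorem map_edgeSet_top {n : ℕ} {φ : Fin n → V} (hφ : Function.Injective φ) :
    Sym2.map φ '' (K n).edgeSet = {e | ¬ e.IsDiag ∧ ∀ v ∈ e, v ∈ Set.range φ} := by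
  ext e
  constructor
  · rintro ⟨e, he, rfl⟩
    induction e with
    | _ a b =>
      have : a ≠ b := he
      refine ⟨by simpa [hφ.eq_iff] using this, ?_⟩
      simp
  · induction e with
    | _ a b =>
      rintro ⟨h1, h2⟩
      obtain ⟨i, rfl⟩ := h2 a (by simp)
      obtain ⟨j, rfl⟩ := h2 b (by simp)
      refine ⟨s(i, j), ?_, rfl⟩
      intro h
      exact h1 (congrArg φ h)

theorem noIsolated_K {n : ℕ} (hn : 2 ≤ n) : NoIsolated (K n) := by
  have : Nontrivial (Fin n) := Fin.nontrivial_iff_two_le.2 hn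
  intro v
  obtain ⟨w, hw⟩ := exists_ne v
  exact ⟨w, hw.symm⟩

/-- The number of complete subgraphs on `n ≥ 2` vertices is the number of `n`-cliques. -/
theorem edgeSubgraphCount_K [Fintype V] [DecidableEq V] (G : SimpleGraph V)
    [DecidableRel G.Adj] {n : ℕ} (hn : 2 ≤ n) :
    edgeSubgraphCount (K n) G = ((G.cliqueFinset n).card : ℤ) := by
  have hE : copiesIn (K n) G.edgeSet =
      (fun s : Finset V => {e : Sym2 V | ¬ e.IsDiag ∧ ∀ v ∈ e, v ∈ (s : Set V)}) ''
        (G.cliqueFinset n : Set (Finset V)) := by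
    ext E
    rw [mem_copiesIn_iff_exists_copy (noIsolated_K hn)]
    constructor
    · rintro ⟨φ, rfl⟩
      refine ⟨Finset.univ.map ⟨φ, φ.injective⟩, ?_, ?_⟩
      · rw [Finset.mem_coe, SimpleGraph.mem_cliqueFinset_iff]
        refine ⟨?_, by simp⟩
        intro a ha b hb hab
        simp only [Finset.coe_map, Finset.coe_univ, Set.image_univ] at ha hb
        obtain ⟨i, rfl⟩ := ha
        obtain ⟨j, rfl⟩ := hb
        exact φ.toHom.map_rel (fun h => hab (by rw [h]))
      · refine Eq.trans ?_ (map_edgeSet_top φ.injective).symm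
        simp
    · rintro ⟨s, hs, rfl⟩
      rw [Finset.mem_coe, SimpleGraph.mem_cliqueFinset_iff] at hs
      let ψ : Fin n ≃ s := (Finset.equivFinOfCardEq hs.2).symm
      have hinj : Function.Injective (fun i => (ψ i).1) :=
        Subtype.val_injective.comp ψ.injective
      refine ⟨⟨⟨fun i => (ψ i).1, ?_⟩, hinj⟩, ?_⟩
      · intro a b h
        exact hs.1 (ψ a).2 (ψ b).2 (fun h' => h (hinj h'))
      · refine (map_edgeSet_top hinj).trans ?_
        have : Set.range (fun i => (ψ i).1) = (s : Set V) := by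
          ext w
          constructor
          · rintro ⟨i, rfl⟩
            exact (ψ i).2
          · intro hw
            exact ⟨ψ.symm ⟨w, hw⟩, by simp⟩
        rw [this]
  rw [edgeSubgraphCount_eq_ncard, hE, Set.InjOn.ncard_image, Set.ncard_coe_finset]
  have key : ∀ s : Finset V, s.card = n → ∀ v,
      v ∈ s ↔ ∃ e ∈ {e : Sym2 V | ¬ e.IsDiag ∧ ∀ v ∈ e, v ∈ (s : Set V)}, v ∈ e := by
    intro s hs v
    constructor
    · intro hv
      obtain ⟨w, hw, hne⟩ := Finset.exists_mem_ne (show 1 < s.card by omega) v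
      exact ⟨s(v, w), ⟨by simpa using hne.symm, by simp [hv, hw]⟩, by simp⟩
    · rintro ⟨e, he, hv⟩
      exact he.2 v hv
  intro s hs t ht h
  rw [Finset.mem_coe, SimpleGraph.mem_cliqueFinset_iff] at hs ht
  ext v
  rw [key s hs.2, key t ht.2]
  simp only at h
  rw [h]

end Counting

/-! ### Counts of connected subgraphs determine the components -/

section Components

variable {V W V' : Type*}

/-- A copy of a connected graph lies in a single component. -/
theorem edgeSubgraphCount_eq_sum_components [Finite V] (G : SimpleGraph V)
    [Fintype G.ConnectedComponent] {T : SimpleGraph W} (hT : T.Connected)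
    (he : T.edgeSet.Nonempty) :
    edgeSubgraphCount T G = ∑ c : G.ConnectedComponent, edgeSubgraphCount T c.toSimpleGraph := by
  have hTI := noIsolated_of_connected hT he
  let S : G.ConnectedComponent → Set (Sym2 V) := fun c =>
    Sym2.map Subtype.val '' c.toSimpleGraph.edgeSet
  have hS : ∀ c, ∀ e ∈ S c, e ∈ G.edgeSet ∧ ∀ v ∈ e, G.connectedComponentMk v = c := by
    rintro c _ ⟨e, he, rfl⟩
    induction e with
    | _ a b =>
      refine ⟨he, ?_⟩
      intro v hv
      rw [Sym2.map_mk, Sym2.mem_iff] at hv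
      rcases hv with rfl | rfl
      · exact a.2
      · exact b.2
  have hne : ∀ c, ∀ E ∈ copiesIn T (S c), E.Nonempty := by
    rintro c E ⟨hE, ⟨θ⟩⟩
    have h1 := ncard_edgeSet_congr θ
    rw [ncard_edgeSet_edgeInduced (G := G) (fun e h => (hS c e (hE h)).1)] at h1
    obtain ⟨e, he⟩ := he
    induction e with
    | _ a b =>
      have h3 := edgeInduced_adj.1 (θ.symm.map_rel_iff.2 he)
      exact ⟨_, h3.1⟩
  have hU : copiesIn T G.edgeSet = ⋃ c, copiesIn T (S c) := by
    ext E
    rw [Set.mem_iUnion]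
    constructor
    · intro hE
      obtain ⟨φ, rfl⟩ := (mem_copiesIn_iff_exists_copy hTI).1 hE
      obtain ⟨t⟩ := hT.nonempty
      have hmk : ∀ s, G.connectedComponentMk (φ s) = G.connectedComponentMk (φ t) := fun s =>
        SimpleGraph.ConnectedComponent.sound ((hT.preconnected s t).map φ.toHom)
      refine ⟨G.connectedComponentMk (φ t), ?_, hE.2⟩
      rintro _ ⟨e, he, rfl⟩
      induction e with
      | _ a b =>
        exact ⟨s(⟨φ a, hmk a⟩, ⟨φ b, hmk b⟩), φ.toHom.map_rel he, rfl⟩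
    · rintro ⟨c, hE, h⟩
      exact ⟨fun e he => (hS c e (hE he)).1, h⟩
  rw [edgeSubgraphCount_eq_ncard, hU, Set.ncard_iUnion_of_finite (fun _ => Set.toFinite _),
    finsum_eq_sum_of_fintype, Nat.cast_sum]
  · refine Finset.sum_congr rfl fun c _ => ?_
    rw [edgeSubgraphCount_eq_ncard, ncard_copiesIn_image Subtype.val_injective]
  · intro c d hcd
    rw [Function.onFun, Set.disjoint_left]
    intro E hc hd
    obtain ⟨e, he⟩ := hne c E hc
    induction e with
    | _ a b =>
      exact hcd (((hS c _ (hc.1 he)).2 a (by simp)).symm.trans ((hS d _ (hd.1 he)).2 a (by simp)))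

/-- Two graphs with isomorphic components are isomorphic. -/
theorem iso_of_components {G : SimpleGraph V} {H : SimpleGraph W}
    (σ : G.ConnectedComponent ≃ H.ConnectedComponent)
    (θ : ∀ c, c.toSimpleGraph ≃g (σ c).toSimpleGraph) : Nonempty (G ≃g H) := by
  let f : V → W := fun v => (θ (G.connectedComponentMk v) ⟨v, rfl⟩).1
  have hf : ∀ c (v : V) (hv : v ∈ c.supp), f v = (θ c ⟨v, hv⟩).1 := by
    rintro _ v rfl
    rfl
  have hmk : ∀ v, H.connectedComponentMk (f v) = σ (G.connectedComponentMk v) := fun v =>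
    (θ (G.connectedComponentMk v) ⟨v, rfl⟩).2
  have hbij : Function.Bijective f := by
    constructor
    · intro v w h
      have hc : G.connectedComponentMk w = G.connectedComponentMk v := by
        apply σ.injective
        rw [← hmk, ← hmk, h]
      rw [hf _ v rfl, hf _ w hc] at h
      have := (θ _).injective (Subtype.ext h)
      exact congrArg Subtype.val this
    · intro w
      obtain ⟨c, hc⟩ := σ.surjective (H.connectedComponentMk w)
      let x := (θ c).symm ⟨w, hc.symm⟩
      refine ⟨x.1, ?_⟩
      rw [hf c x.1 x.2]
      change (θ c ((θ c).symm ⟨w, hc.symm⟩)).1 = w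
      rw [RelIso.apply_symm_apply]
  refine ⟨⟨Equiv.ofBijective f hbij, ?_⟩⟩
  intro a b
  change H.Adj (f a) (f b) ↔ G.Adj a b
  constructor
  · intro h
    have hc : G.connectedComponentMk b = G.connectedComponentMk a := by
      apply σ.injective
      rw [← hmk, ← hmk]
      exact (SimpleGraph.ConnectedComponent.connectedComponentMk_eq_of_adj h).symm
    rw [hf _ a rfl, hf _ b hc] at h
    exact (θ (G.connectedComponentMk a)).map_rel_iff.1 h
  · intro h
    have hc : G.connectedComponentMk b = G.connectedComponentMk a :=
      (SimpleGraph.ConnectedComponent.connectedComponentMk_eq_of_adj h).symm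
    rw [hf _ a rfl, hf _ b hc]
    exact (θ (G.connectedComponentMk a)).map_rel_iff.2 h

/-- A multiset is determined by its sums against a triangular system of weights. -/
theorem multiset_eq_of_triangular {α : Type*} (r : α → ℕ) (q : α → α → ℤ) {M N : Multiset α}
    (hself : ∀ t ∈ M + N, q t t ≠ 0)
    (htri : ∀ t ∈ M + N, ∀ s ∈ M + N, q t s ≠ 0 → s = t ∨ r t < r s)
    (h : ∀ t ∈ M + N, (M.map (q t)).sum = (N.map (q t)).sum) : M = N := by
  classical
  by_contra hMN
  let S := (M + N).toFinset.filter fun t => M.count t ≠ N.count t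
  have hS : S.Nonempty := by
    by_contra hS
    apply hMN
    ext t
    by_contra ht
    apply hS
    refine ⟨t, Finset.mem_filter.2 ⟨?_, ht⟩⟩
    rw [Multiset.mem_toFinset, ← Multiset.count_pos, Multiset.count_add]
    omega
  -- At an index of largest rank with different multiplicities, no other term can compensate.
  obtain ⟨t, htS, hmax⟩ := Finset.exists_max_image S r hS
  obtain ⟨ht, hne⟩ := Finset.mem_filter.1 htS
  have expand : ∀ L : Multiset α, L ≤ M + N →
      (L.map (q t)).sum = ∑ s ∈ (M + N).toFinset, (L.count s : ℤ) * q t s := by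
    intro L hL
    rw [Finset.sum_multiset_map_count]
    simp only [nsmul_eq_mul]
    refine Finset.sum_subset (Multiset.toFinset_subset.2 (Multiset.subset_of_le hL)) ?_
    intro s _ hs
    rw [Multiset.mem_toFinset] at hs
    simp [Multiset.count_eq_zero_of_notMem hs]
  have h0 := h t (Multiset.mem_toFinset.1 ht)
  rw [expand M (Multiset.le_add_right _ _), expand N (Multiset.le_add_left _ _), ← sub_eq_zero,
    ← Finset.sum_sub_distrib, Finset.sum_eq_single t] at h0
  · rw [← sub_mul, mul_eq_zero] at h0
    rcases h0 with h0 | h0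
    · omega
    · exact hself t (Multiset.mem_toFinset.1 ht) h0
  · intro s hs hst
    rw [← sub_mul]
    by_cases hq : q t s = 0
    · rw [hq, mul_zero]
    · rcases htri t (Multiset.mem_toFinset.1 ht) s (Multiset.mem_toFinset.1 hs) hq with h1 | h1
      · exact absurd h1 hst
      · have : M.count s = N.count s := by
          by_contra hc
          have := hmax s (Finset.mem_filter.2 ⟨hs, hc⟩)
          omega
        rw [this, sub_self, zero_mul]
  · intro h1
    exact absurd ht h1

end Components

namespace UnlabelledGraph

theorem exists_rep (x : UnlabelledGraph) :
    ∃ (n : ℕ) (A : SimpleGraph (Fin n)), x = unlabelled A := by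
  induction x using Quotient.inductionOn with
  | _ A =>
    refine ⟨A.1, A.2, Quotient.sound ⟨?_⟩⟩
    exact SimpleGraph.Iso.map (Finite.equivFin (Fin A.1)) A.2

variable {V W : Type*} [Finite V] [Finite W]

theorem edgeLE_unlabelled {T : SimpleGraph W} {G : SimpleGraph V} :
    EdgeLE (unlabelled T) (unlabelled G) ↔ IsEdgeSubgraph T G :=
  (isEdgeSubgraph_congr (SimpleGraph.Iso.map (Finite.equivFin W) T)
    (SimpleGraph.Iso.map (Finite.equivFin V) G)).symm

theorem q_unlabelled (T : SimpleGraph W) (G : SimpleGraph V) :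
    q (unlabelled T) (unlabelled G) = edgeSubgraphCount T G :=
  (edgeSubgraphCount_congr (SimpleGraph.Iso.map (Finite.equivFin W) T)
    (SimpleGraph.Iso.map (Finite.equivFin V) G)).symm

theorem numEdges_unlabelled (G : SimpleGraph V) :
    numEdges (unlabelled G) = G.edgeSet.ncard :=
  (ncard_edgeSet_congr (SimpleGraph.Iso.map (Finite.equivFin V) G)).symm

theorem unlabelled_congr {T : SimpleGraph W} {G : SimpleGraph V} (φ : T ≃g G) :
    unlabelled T = unlabelled G := (unlabelled_eq_iff _ _).2 ⟨φ⟩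

end UnlabelledGraph

theorem exists_connected_rep_component {V : Type*} [Finite V] {G : SimpleGraph V}
    (hG : NoIsolated G) (c : G.ConnectedComponent) : ∃ (n : ℕ) (T : SimpleGraph (Fin n)),
      unlabelled c.toSimpleGraph = unlabelled T ∧ T.Connected ∧ T.edgeSet.Nonempty := by
  obtain ⟨n, T, hT⟩ := UnlabelledGraph.exists_rep (unlabelled c.toSimpleGraph)
  obtain ⟨φ⟩ := (unlabelled_eq_iff _ _).1 hT
  refine ⟨n, T, hT, φ.connected_iff.1 c.connected_toSimpleGraph, ?_⟩
  obtain ⟨v, rfl⟩ := c.exists_rep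
  obtain ⟨w, hw⟩ := hG v
  exact ⟨s(φ ⟨v, rfl⟩, φ ⟨w, (SimpleGraph.ConnectedComponent.connectedComponentMk_eq_of_adj
    hw).symm⟩), φ.map_rel_iff.2 hw⟩

open UnlabelledGraph in
/-- The numbers of connected subgraphs of each type determine a graph without isolated
vertices: if a type occurs differently often as a component, then a largest such type also
occurs differently often as a subgraph. -/
theorem iso_of_edgeSubgraphCount_connected {V W : Type*} [Finite V] [Finite W]
    {G : SimpleGraph V} {H : SimpleGraph W} (hG : NoIsolated G) (hH : NoIsolated H)
    (h : ∀ (n : ℕ) (T : SimpleGraph (Fin n)), T.Connected → T.edgeSet.Nonempty →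
      edgeSubgraphCount T G = edgeSubgraphCount T H) : Nonempty (G ≃g H) := by
  classical
  have := Fintype.ofFinite G.ConnectedComponent
  have := Fintype.ofFinite H.ConnectedComponent
  let M : Multiset UnlabelledGraph :=
    (Finset.univ : Finset G.ConnectedComponent).val.map fun c => unlabelled c.toSimpleGraph
  let N : Multiset UnlabelledGraph :=
    (Finset.univ : Finset H.ConnectedComponent).val.map fun c => unlabelled c.toSimpleGraph
  have hmem : ∀ t ∈ M + N, ∃ (n : ℕ) (T : SimpleGraph (Fin n)),
      t = unlabelled T ∧ T.Connected ∧ T.edgeSet.Nonempty := by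
    intro t ht
    rcases Multiset.mem_add.1 ht with ht | ht
    · obtain ⟨c, _, rfl⟩ := Multiset.mem_map.1 ht
      exact exists_connected_rep_component hG c
    · obtain ⟨c, _, rfl⟩ := Multiset.mem_map.1 ht
      exact exists_connected_rep_component hH c
  have hMN : M = N := by
    refine multiset_eq_of_triangular numEdges q ?_ ?_ ?_
    · intro t ht
      obtain ⟨n, T, rfl, hT, he⟩ := hmem t ht
      rw [q_unlabelled, edgeSubgraphCount_self (noIsolated_of_connected hT he) SimpleGraph.Iso.refl]
      exact one_ne_zero
    · intro t ht s hs
      obtain ⟨n, T, rfl, hT, he⟩ := hmem t ht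
      obtain ⟨m, S, rfl, hS, hf⟩ := hmem s hs
      rw [q_unlabelled, edgeSubgraphCount_ne_zero_iff, numEdges_unlabelled, numEdges_unlabelled]
      intro hTS
      rw [or_iff_not_imp_right, not_lt]
      intro hle
      obtain ⟨φ⟩ := hTS.iso_of_ncard_le (noIsolated_of_connected hS hf) hle
      exact (unlabelled_congr φ).symm
    · intro t ht
      obtain ⟨n, T, rfl, hT, he⟩ := hmem t ht
      simp only [M, N, Multiset.map_map, Function.comp_def, q_unlabelled]
      change ∑ c : G.ConnectedComponent, edgeSubgraphCount T c.toSimpleGraph =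
        ∑ c : H.ConnectedComponent, edgeSubgraphCount T c.toSimpleGraph
      rw [← edgeSubgraphCount_eq_sum_components G hT he,
        ← edgeSubgraphCount_eq_sum_components H hT he]
      exact h n T hT he
  have hfib : ∀ t : UnlabelledGraph,
      Nonempty ({c : G.ConnectedComponent // unlabelled c.toSimpleGraph = t} ≃
        {c : H.ConnectedComponent // unlabelled c.toSimpleGraph = t}) := by
    intro t
    refine ⟨Fintype.equivOfCardEq ?_⟩
    have := congrArg (Multiset.count t) hMN
    rw [Multiset.count_map, Multiset.count_map] at this
    rw [Fintype.card_subtype, Fintype.card_subtype]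
    simpa [Finset.card, eq_comm] using this
  have e := fun t => (hfib t).some
  have hσ := Equiv.ofFiberEquiv_map e
  exact iso_of_components (Equiv.ofFiberEquiv e)
    fun c => ((unlabelled_eq_iff _ _).1 (hσ c)).some.symm

/-! ### Connectedness and the number of pairs of adjacent edges -/

section Connectedness

variable {V W : Type*}

theorem mem_copiesIn_star_two_iff {G : SimpleGraph V} {E : Set (Sym2 V)} :
    E ∈ copiesIn (Star 2) G.edgeSet ↔
      ∃ w u v, G.Adj w u ∧ G.Adj w v ∧ u ≠ v ∧ E = {s(w, u), s(w, v)} := by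
  rw [mem_copiesIn_iff_exists_copy (noIsolated_star (by norm_num))]
  constructor
  · rintro ⟨φ, rfl⟩
    refine ⟨φ (Sum.inl 0), φ (Sum.inr 0), φ (Sum.inr 1), φ.toHom.map_rel (by simp),
      φ.toHom.map_rel (by simp), fun h => ?_, ?_⟩
    · simpa using φ.injective h
    · refine (map_edgeSet_star _).trans ?_
      ext e
      simp [Fin.exists_fin_two, eq_comm]
  · rintro ⟨w, u, v, hu, hv, huv, rfl⟩
    refine ⟨⟨⟨Sum.elim (fun _ => w) ![u, v], ?_⟩, ?_⟩, ?_⟩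
    · rintro (a | a) (b | b) h
      · simp at h
      · fin_cases b <;> simpa
      · fin_cases a <;> simp [hu.symm, hv.symm]
      · simp at h
    · rintro (a | a) (b | b) h
      · rw [Subsingleton.elim a b]
      · fin_cases b
        · exact absurd h hu.ne
        · exact absurd h hv.ne
      · fin_cases a
        · exact absurd h hu.ne'
        · exact absurd h hv.ne'
      · fin_cases a <;> fin_cases b <;> simp_all [huv.symm]
    · refine (map_edgeSet_star _).trans ?_
      ext e
      simp [Fin.exists_fin_two, eq_comm]
      rfl

theorem copiesIn_mono (T : SimpleGraph W) {S S' : Set (Sym2 V)} (h : S ⊆ S') :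
    copiesIn T S ⊆ copiesIn T S' := fun _ hE => ⟨hE.1.trans h, hE.2⟩

/-- In a connected graph with at least two edges, some edge can be deleted such that the remaining
edges induce a connected graph with fewer pairs of adjacent edges. Any edge at a vertex whose
removal leaves a connected graph will do. -/
theorem exists_connected_edgeInduced [Finite V] {G : SimpleGraph V} (hG : G.Connected)
    (he : 2 ≤ G.edgeSet.ncard) :
    ∃ E ⊆ G.edgeSet, E.ncard + 1 = G.edgeSet.ncard ∧ (edgeInduced E).Connected ∧
      (copiesIn (Star 2) E).ncard < (copiesIn (Star 2) G.edgeSet).ncard := by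
  have hne : G.edgeSet.Nonempty := by
    rw [← Set.ncard_pos]
    omega
  have hGI := noIsolated_of_connected hG hne
  have : Nontrivial V := by
    obtain ⟨v⟩ := hG.nonempty
    obtain ⟨w, hw⟩ := hGI v
    exact ⟨v, w, hw.ne⟩
  obtain ⟨v, hv⟩ := hG.exists_connected_induce_compl_singleton_of_finite_nontrivial
  obtain ⟨w, hw⟩ := hGI v
  have hwv : w ∈ ({v}ᶜ : Set V) := by simpa using hw.ne'
  -- A second edge has an end other than `v` and `w`.
  have hnt : Nontrivial ({v}ᶜ : Set V) := by
    obtain ⟨e, heG, hee⟩ := Set.exists_ne_of_one_lt_ncard (by omega : 1 < G.edgeSet.ncard) s(v, w)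
    induction e with
    | _ a b =>
      have hab : G.Adj a b := heG
      by_cases ha : a = v
      · subst ha
        have hb : b ∈ ({a}ᶜ : Set V) := by simpa using hab.ne'
        refine ⟨⟨b, hb⟩, ⟨w, hwv⟩, fun h => hee ?_⟩
        have : b = w := Subtype.ext_iff.1 h
        rw [this]
      · by_cases haw : a = w
        · subst haw
          by_cases hb : b = v
          · subst hb
            exact absurd Sym2.eq_swap hee
          · exact ⟨⟨a, hwv⟩, ⟨b, hb⟩, fun h => hab.ne (Subtype.ext_iff.1 h)⟩
        · exact ⟨⟨a, ha⟩, ⟨w, hwv⟩, fun h => haw (Subtype.ext_iff.1 h)⟩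
  have hnb : ∀ x : V, x ≠ v → ∃ y, y ≠ v ∧ G.Adj x y := by
    intro x hx
    obtain ⟨y, hy⟩ := hv.preconnected.exists_adj_of_nontrivial ⟨x, hx⟩
    exact ⟨y.1, y.2, hy⟩
  let E := G.edgeSet \ {s(v, w)}
  have hEG : E ⊆ G.edgeSet := Set.sdiff_subset
  have hE : ∀ {x y : V}, x ≠ v → y ≠ v → G.Adj x y → s(x, y) ∈ E := by
    intro x y hx hy h
    refine ⟨h, fun h' => ?_⟩
    have : v ∈ s(x, y) := by
      rw [Set.mem_singleton_iff.1 h']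
      simp
    rcases Sym2.mem_iff.1 this with h | h
    · exact hx h.symm
    · exact hy h.symm
  have hmemE : ∀ x : V, x ≠ v → ∃ e ∈ E, x ∈ e := by
    intro x hx
    obtain ⟨y, hy, hxy⟩ := hnb x hx
    exact ⟨s(x, y), hE hx hy hxy, by simp⟩
  refine ⟨E, hEG, Set.ncard_sdiff_singleton_add_one (show s(v, w) ∈ G.edgeSet from hw), ?_, ?_⟩
  · let ι : G.induce ({v}ᶜ : Set V) →g edgeInduced E :=
      { toFun := fun x => ⟨x.1, hmemE x.1 x.2⟩
        map_rel' := fun {a b} h => edgeInduced_adj.2 ⟨hE a.2 b.2 h, SimpleGraph.Adj.ne h⟩ }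
    have hreach : ∀ x, (edgeInduced E).Reachable x ⟨w, hmemE w hwv⟩ := by
      rintro ⟨x, hx⟩
      by_cases hxv : x = v
      · subst hxv
        obtain ⟨e, heE, hxe⟩ := hx
        obtain ⟨y, rfl⟩ := Sym2.mem_iff_exists.1 hxe
        have hxy : G.Adj x y := hEG heE
        have h1 := (hv.preconnected ⟨y, hxy.ne'⟩ ⟨w, hwv⟩).map ι
        refine SimpleGraph.Reachable.trans (SimpleGraph.Adj.reachable ?_) h1
        exact edgeInduced_adj.2 ⟨heE, hxy.ne⟩
      · exact (hv.preconnected ⟨x, hxv⟩ ⟨w, hwv⟩).map ι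
    have : Nonempty {x : V // ∃ e ∈ E, x ∈ e} := ⟨⟨w, hmemE w hwv⟩⟩
    exact ⟨fun x y => (hreach x).trans (hreach y).symm⟩
  · refine Set.ncard_lt_ncard ?_ (Set.toFinite _)
    rw [Set.ssubset_iff_exists]
    refine ⟨copiesIn_mono _ hEG, ?_⟩
    obtain ⟨u, huv, hwu⟩ := hnb w hwv
    refine ⟨{s(w, v), s(w, u)}, mem_copiesIn_star_two_iff.2
      ⟨w, v, u, hw.symm, hwu, huv.symm, rfl⟩, fun h => ?_⟩
    exact (h.1 (Set.mem_insert _ _)).2 Sym2.eq_swap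

theorem exists_connected_isEdgeSubgraph [Finite V] {G : SimpleGraph V} (hG : G.Connected)
    (he : 2 ≤ G.edgeSet.ncard) :
    ∃ (n : ℕ) (T : SimpleGraph (Fin n)), IsEdgeSubgraph T G ∧ T.Connected ∧
      T.edgeSet.ncard + 1 = G.edgeSet.ncard ∧
      edgeSubgraphCount (Star 2) T < edgeSubgraphCount (Star 2) G := by
  obtain ⟨E, hE, hc, hconn, hlt⟩ := exists_connected_edgeInduced hG he
  obtain ⟨n, T, hT⟩ := UnlabelledGraph.exists_rep (unlabelled (edgeInduced E))
  obtain ⟨φ⟩ := (unlabelled_eq_iff _ _).1 hT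
  refine ⟨n, T, ⟨E, hE, ⟨φ⟩⟩, φ.connected_iff.1 hconn, ?_, ?_⟩
  · rw [← ncard_edgeSet_congr φ, ncard_edgeSet_edgeInduced hE, hc]
  · rw [← edgeSubgraphCount_congr SimpleGraph.Iso.refl φ, edgeSubgraphCount_edgeInduced hE,
      edgeSubgraphCount_eq_ncard]
    exact_mod_cast hlt

/-- An edge added to a connected graph keeps it connected as soon as it creates a new pair of
adjacent edges. -/
theorem connected_of_isEdgeSubgraph [Finite V] {G : SimpleGraph V} (hG : NoIsolated G)
    {T : SimpleGraph W} (hT : T.Connected) (hTG : IsEdgeSubgraph T G)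
    (he : T.edgeSet.ncard + 1 = G.edgeSet.ncard)
    (hlt : edgeSubgraphCount (Star 2) T < edgeSubgraphCount (Star 2) G) : G.Connected := by
  obtain ⟨E, hE, ⟨φ⟩⟩ := hTG
  have hconn : (edgeInduced E).Connected := φ.connected_iff.2 hT
  rw [← ncard_edgeSet_congr φ, ncard_edgeSet_edgeInduced hE] at he
  rw [← edgeSubgraphCount_congr SimpleGraph.Iso.refl φ, edgeSubgraphCount_edgeInduced hE,
      edgeSubgraphCount_eq_ncard, Nat.cast_lt] at hlt
  -- At most one edge lies outside `E`.
  have huniq : ∀ e f, e ∈ G.edgeSet → f ∈ G.edgeSet → e ∉ E → f ∉ E → e = f := by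
    intro e f heG hfG heE hfE
    have h1 : (G.edgeSet \ E).ncard ≤ 1 := by
      have := Set.ncard_sdiff_add_ncard_of_subset hE
      omega
    exact (Set.ncard_le_one (Set.toFinite _)).1 h1 e ⟨heG, heE⟩ f ⟨hfG, hfE⟩
  obtain ⟨S, hSG, hSE⟩ := Set.exists_mem_notMem_of_ncard_lt_ncard hlt
  obtain ⟨w, u, v, hu, hv, huv, rfl⟩ := mem_copiesIn_star_two_iff.1 hSG
  have hstar : ∃ u v, G.Adj w u ∧ G.Adj w v ∧ s(w, u) ∈ E ∧ s(w, v) ∉ E := by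
    by_cases h1 : s(w, u) ∈ E
    · refine ⟨u, v, hu, hv, h1, fun h2 => hSE ⟨?_, hSG.2⟩⟩
      rintro e (rfl | rfl)
      · exact h1
      · exact h2
    · refine ⟨v, u, hv, hu, ?_, h1⟩
      by_contra h2
      exact huv (Sym2.congr_right.1 (huniq _ _ hu hv h1 h2))
  obtain ⟨u, v, hu, hv, huE, hvE⟩ := hstar
  let ι : edgeInduced E →g G :=
    { toFun := Subtype.val
      map_rel' := fun {a b} h => hE (edgeInduced_adj.1 h).1 }
  have hreach : ∀ x, G.Reachable x w := by
    intro x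
    obtain ⟨y, hxy⟩ := hG x
    by_cases hE' : s(x, y) ∈ E
    · exact (hconn.preconnected ⟨x, _, hE', by simp⟩ ⟨w, _, huE, by simp⟩).map ι
    · have h1 : x ∈ s(w, v) := by
        rw [huniq _ _ hv hxy hvE hE']
        simp
      rcases Sym2.mem_iff.1 h1 with rfl | rfl
      · exact SimpleGraph.Reachable.rfl
      · exact hv.symm.reachable
  have : Nonempty V := ⟨w⟩
  exact ⟨fun x y => (hreach x).trans (hreach y).symm⟩

end Connectedness

/-! ### Connected graphs without `T_4` and `K_{1,4}` -/

section Classification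

variable {V W : Type*}

instance decidableRelStarAdj (m : ℕ) : DecidableRel (Star m).Adj := fun a b =>
  inferInstanceAs (Decidable (a.isLeft ∧ b.isRight ∨ a.isRight ∧ b.isLeft))

theorem cycleGraph_adj_of_lt {n : ℕ} {u v : Fin n} (h : u < v) :
    (C n).Adj u v ↔ u.val + 1 = v.val ∨ (u.val = 0 ∧ v.val + 1 = n ∧ 2 ≤ n) := by
  have h1 : (v - u).val = v.val - u.val := Fin.coe_sub_iff_le.2 h.le
  have h2 : (u - v).val = n + u.val - v.val := Fin.coe_sub_iff_lt.2 h
  have h3 : u.val < v.val := h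
  have h4 := v.isLt
  rw [SimpleGraph.cycleGraph_adj', h1, h2]
  omega

/-- A bijection that matches adjacency on increasing pairs is an isomorphism. -/
theorem iso_of_lt {n : ℕ} {G : SimpleGraph V} {A : SimpleGraph (Fin n)} (f : Fin n → V)
    (hf : Function.Bijective f) (h : ∀ i j, i < j → (G.Adj (f i) (f j) ↔ A.Adj i j)) :
    Nonempty (G ≃g A) := by
  refine ⟨SimpleGraph.Iso.symm ⟨Equiv.ofBijective f hf, ?_⟩⟩
  intro i j
  change G.Adj (f i) (f j) ↔ A.Adj i j
  rcases lt_trichotomy i j with hij | rfl | hij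
  · exact h i j hij
  · simp
  · rw [G.adj_comm, A.adj_comm, h j i hij]

theorem isContained_T4 {G : SimpleGraph V} {v a b c d : V} (hva : G.Adj v a) (hvb : G.Adj v b)
    (hvc : G.Adj v c) (hcd : G.Adj c d) (hab : a ≠ b) (hac : a ≠ c) (hbc : b ≠ c)
    (hda : d ≠ a) (hdb : d ≠ b) (hdv : d ≠ v) : T4.IsContained G := by
  have h1 := hva.ne
  have h2 := hvb.ne
  have h3 := hvc.ne
  have h4 := hcd.ne
  refine ⟨⟨⟨![v, a, b, c, d], ?_⟩, ?_⟩⟩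
  · intro i j h
    fin_cases i <;> fin_cases j <;> simp_all [T4, SimpleGraph.adj_comm]
  · intro i j h
    fin_cases i <;> fin_cases j <;> simp_all

theorem star_isContained_iff [Fintype V] {G : SimpleGraph V} [DecidableRel G.Adj] {m : ℕ}
    (hm : 2 ≤ m) : (Star m).IsContained G ↔ ∃ v, m ≤ G.degree v := by
  classical
  have h1 : (Star m).IsContained G ↔ IsEdgeSubgraph (Star m) G := by
    rw [isEdgeSubgraph_iff]
    exact ⟨fun h => ⟨noIsolated_star (by omega), h⟩, fun h => h.2⟩
  rw [h1, ← edgeSubgraphCount_ne_zero_iff, edgeSubgraphCount_star G hm, Nat.cast_ne_zero, ne_eq,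
    Finset.sum_eq_zero_iff, not_forall]
  simp [Nat.choose_eq_zero_iff]

/-- The graph contains neither `T_4` nor `K_{1,4}`. -/
def IsThin (G : SimpleGraph V) : Prop := ¬ T4.IsContained G ∧ ¬ (Star 4).IsContained G

theorem IsThin.of_isContained {G : SimpleGraph V} {H : SimpleGraph W} (hG : IsThin G)
    (h : H.IsContained G) : IsThin H := ⟨fun h' => hG.1 (h'.trans h), fun h' => hG.2 (h'.trans h)⟩

/-- In a connected graph, a nonempty set of vertices closed under adjacency is everything. -/
theorem mem_of_closed {G : SimpleGraph V} (hG : G.Connected) {s : Set V} {v : V} (hv : v ∈ s)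
    (hs : ∀ x ∈ s, ∀ y, G.Adj x y → y ∈ s) (w : V) : w ∈ s := by
  obtain ⟨p⟩ := hG.preconnected v w
  induction p with
  | nil => exact hv
  | cons h _ ih => exact ih (hs _ hv _ h)

/-- Identification of a graph on four vertices by the adjacency of its pairs. -/
theorem iso_of_four {G : SimpleGraph V} {A : SimpleGraph (Fin 4)} {x y z w : V}
    (hall : ∀ u, u = x ∨ u = y ∨ u = z ∨ u = w) (hxy : x ≠ y) (hxz : x ≠ z) (hxw : x ≠ w)
    (hyz : y ≠ z) (hyw : y ≠ w) (hzw : z ≠ w) (h01 : G.Adj x y ↔ A.Adj 0 1)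
    (h02 : G.Adj x z ↔ A.Adj 0 2) (h03 : G.Adj x w ↔ A.Adj 0 3) (h12 : G.Adj y z ↔ A.Adj 1 2)
    (h13 : G.Adj y w ↔ A.Adj 1 3) (h23 : G.Adj z w ↔ A.Adj 2 3) : Nonempty (G ≃g A) := by
  refine iso_of_lt ![x, y, z, w] ⟨?_, ?_⟩ ?_
  · intro i j h
    fin_cases i <;> fin_cases j <;> first | rfl | exact absurd h ‹_› | exact absurd h.symm ‹_›
  · intro u
    rcases hall u with rfl | rfl | rfl | rfl
    exacts [⟨0, rfl⟩, ⟨1, rfl⟩, ⟨2, rfl⟩, ⟨3, rfl⟩]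
  · intro i j hij
    fin_cases i <;> fin_cases j <;> first | assumption | exact absurd hij (by decide)

/-- A vertex with three neighbours has no vertex at distance two, which would give a `T_4`, and no
fourth neighbour. -/
theorem exists_iso_of_three_neighbors [Finite V] {G : SimpleGraph V} (hG : G.Connected)
    (hthin : IsThin G) {v a b c : V} (ha : G.Adj v a) (hb : G.Adj v b) (hc : G.Adj v c)
    (hab : a ≠ b) (hac : a ≠ c) (hbc : b ≠ c) :
    Nonempty (G ≃g Star 3) ∨ Nonempty (G ≃g S4) ∨ Nonempty (G ≃g K4e) ∨ Nonempty (G ≃g K 4) := by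
  classical
  have := Fintype.ofFinite V
  have hnv : ∀ y, G.Adj v y → y = a ∨ y = b ∨ y = c := by
    intro y hy
    by_contra! h
    refine hthin.2 ((star_isContained_iff (by norm_num)).2 ⟨v, ?_⟩)
    have h1 : ({a, b, c, y} : Finset V) ⊆ G.neighborFinset v := by
      intro x hx
      rw [SimpleGraph.mem_neighborFinset]
      simp only [Finset.mem_insert, Finset.mem_singleton] at hx
      rcases hx with rfl | rfl | rfl | rfl <;> assumption
    have h2 : ({a, b, c, y} : Finset V).card = 4 := by
      rw [Finset.card_insert_of_notMem, Finset.card_insert_of_notMem, Finset.card_pair]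
      · exact h.2.2.symm
      · simp [hbc, h.2.1.symm]
      · simp [hab, hac, h.1.symm]
    rw [← h2]
    exact Finset.card_le_card h1
  have hclosed : ∀ x ∈ ({v, a, b, c} : Set V), ∀ y, G.Adj x y → y ∈ ({v, a, b, c} : Set V) := by
    intro x hx y hy
    simp only [Set.mem_insert_iff, Set.mem_singleton_iff] at hx ⊢
    rcases hx with rfl | rfl | rfl | rfl
    · exact Or.inr (hnv y hy)
    · by_contra! h
      exact hthin.1 (isContained_T4 hb hc ha hy hbc hab.symm hac.symm h.2.2.1 h.2.2.2 h.1)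
    · by_contra! h
      exact hthin.1 (isContained_T4 ha hc hb hy hac hab hbc.symm h.2.1 h.2.2.2 h.1)
    · by_contra! h
      exact hthin.1 (isContained_T4 ha hb hc hy hab hac hbc h.2.1 h.2.2.1 h.1)
  have hall : ∀ w, w = v ∨ w = a ∨ w = b ∨ w = c := fun w => by
    simpa using mem_of_closed hG (Set.mem_insert v {a, b, c}) hclosed w
  have hva := ha.ne
  have hvb := hb.ne
  have hvc := hc.ne
  have hs : ∀ {p q : Prop}, p → q → (p ↔ q) := iff_of_true
  have hn : ∀ {p q : Prop}, ¬ p → ¬ q → (p ↔ q) := iff_of_false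
  have all₁ : ∀ w, w = v ∨ w = a ∨ w = c ∨ w = b := fun w => by have := hall w; tauto
  have all₂ : ∀ w, w = v ∨ w = b ∨ w = c ∨ w = a := fun w => by have := hall w; tauto
  have all₃ : ∀ w, w = b ∨ w = c ∨ w = v ∨ w = a := fun w => by have := hall w; tauto
  have all₄ : ∀ w, w = a ∨ w = c ∨ w = v ∨ w = b := fun w => by have := hall w; tauto
  have all₅ : ∀ w, w = a ∨ w = b ∨ w = v ∨ w = c := fun w => by have := hall w; tauto
  have star : (Star 3).comap (finSumFinEquiv (m := 1) (n := 3)).symm ≃g Star 3 :=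
    SimpleGraph.Iso.comap _ _
  by_cases h1 : G.Adj a b <;> by_cases h2 : G.Adj a c <;> by_cases h3 : G.Adj b c
  · refine Or.inr (Or.inr (Or.inr (iso_of_four hall hva hvb hvc hab hac hbc ?_ ?_ ?_ ?_ ?_ ?_)))
    exacts [hs ha (by decide), hs hb (by decide), hs hc (by decide), hs h1 (by decide),
      hs h2 (by decide), hs h3 (by decide)]
  · refine Or.inr (Or.inr (Or.inl (iso_of_four all₃ hbc hvb.symm hab.symm hvc.symm hac.symm hva
      ?_ ?_ ?_ ?_ ?_ ?_)))
    exacts [hn h3 (by simp [K4e]), hs hb.symm (by simp [K4e]), hs h1.symm (by simp [K4e]),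
      hs hc.symm (by simp [K4e]), hs h2.symm (by simp [K4e]), hs ha (by simp [K4e])]
  · refine Or.inr (Or.inr (Or.inl (iso_of_four all₄ hac hva.symm hab hvc.symm hbc.symm hvb
      ?_ ?_ ?_ ?_ ?_ ?_)))
    exacts [hn h2 (by simp [K4e]), hs ha.symm (by simp [K4e]), hs h1 (by simp [K4e]),
      hs hc.symm (by simp [K4e]), hs h3.symm (by simp [K4e]), hs hb (by simp [K4e])]
  · refine Or.inr (Or.inl (iso_of_four hall hva hvb hvc hab hac hbc ?_ ?_ ?_ ?_ ?_ ?_))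
    exacts [hs ha (by simp [S4]), hs hb (by simp [S4]), hs hc (by simp [S4]), hs h1 (by simp [S4]),
      hn h2 (by simp [S4]), hn h3 (by simp [S4])]
  · refine Or.inr (Or.inr (Or.inl (iso_of_four all₅ hab hva.symm hac hvb.symm hbc hvc
      ?_ ?_ ?_ ?_ ?_ ?_)))
    exacts [hn h1 (by simp [K4e]), hs ha.symm (by simp [K4e]), hs h2 (by simp [K4e]),
      hs hb.symm (by simp [K4e]), hs h3 (by simp [K4e]), hs hc (by simp [K4e])]
  · refine Or.inr (Or.inl (iso_of_four all₁ hva hvc hvb hac hab hbc.symm ?_ ?_ ?_ ?_ ?_ ?_))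
    exacts [hs ha (by simp [S4]), hs hc (by simp [S4]), hs hb (by simp [S4]), hs h2 (by simp [S4]),
      hn h1 (by simp [S4]), hn (fun h => h3 h.symm) (by simp [S4])]
  · refine Or.inr (Or.inl (iso_of_four all₂ hvb hvc hva hbc hab.symm hac.symm ?_ ?_ ?_ ?_ ?_ ?_))
    exacts [hs hb (by simp [S4]), hs hc (by simp [S4]), hs ha (by simp [S4]), hs h3 (by simp [S4]),
      hn (fun h => h1 h.symm) (by simp [S4]), hn (fun h => h2 h.symm) (by simp [S4])]
  · obtain ⟨φ⟩ : Nonempty (G ≃g (Star 3).comap (finSumFinEquiv (m := 1) (n := 3)).symm) := by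
      refine iso_of_four hall hva hvb hvc hab hac hbc ?_ ?_ ?_ ?_ ?_ ?_
      exacts [hs ha (by decide), hs hb (by decide), hs hc (by decide), hn h1 (by decide),
        hn h2 (by decide), hn h3 (by decide)]
    exact Or.inl ⟨φ.trans star⟩

/-- A connected graph with all degrees at most two is a path or a cycle. -/
theorem exists_iso_path_or_cycle [Finite V] {G : SimpleGraph V} (hG : G.Connected)
    (hdeg : ∀ v a b c, G.Adj v a → G.Adj v b → G.Adj v c → a = b ∨ a = c ∨ b = c) :
    ∃ n, Nonempty (G ≃g P n) ∨ (3 ≤ n ∧ Nonempty (G ≃g C n)) := by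
  classical
  have := Fintype.ofFinite V
  obtain ⟨v₀⟩ := hG.nonempty
  let p : ℕ → Prop := fun n => (P n).IsContained G
  have hp1 : p 1 := by
    refine ⟨⟨⟨fun _ => v₀, ?_⟩, fun i j _ => Subsingleton.elim i j⟩⟩
    intro a b h
    exact absurd (Subsingleton.elim a b) h.ne
  have hbound : ∀ n, p n → n ≤ Fintype.card V := by
    rintro n ⟨φ⟩
    simpa using Fintype.card_le_of_injective φ φ.injective
  -- Take a longest path.
  let n := Nat.findGreatest p (Fintype.card V)
  have hn : p n := Nat.findGreatest_spec (hbound 1 hp1) hp1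
  have hn1 : 1 ≤ n := Nat.le_findGreatest (hbound 1 hp1) hp1
  have hmax : ¬ p (n + 1) := fun h => by
    have : n + 1 ≤ n := Nat.le_findGreatest (hbound _ h) h
    omega
  obtain ⟨f⟩ := hn
  have hinj : Function.Injective f := f.injective
  have hadj : ∀ i j : Fin n, i.val + 1 = j.val → G.Adj (f i) (f j) := fun i j h =>
    f.toHom.map_rel (SimpleGraph.pathGraph_adj.2 (Or.inl h))
  have hrange : ∀ i y, G.Adj (f i) y → y ∈ Set.range f := by
    intro i y hy
    by_contra hyr
    have hyf : ∀ j, f j ≠ y := fun j h => hyr ⟨j, h⟩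
    by_cases h0 : i.val = 0
    · refine hmax ⟨⟨⟨Fin.cons y f, ?_⟩, ?_⟩⟩
      · intro a b hab
        rw [SimpleGraph.pathGraph_adj] at hab
        induction a using Fin.cases with
        | zero =>
          induction b using Fin.cases with
          | zero => simp at hab
          | succ b =>
            have : b = i := Fin.ext (by simp at hab; omega)
            simpa [this] using hy.symm
        | succ a =>
          induction b using Fin.cases with
          | zero =>
            have : a = i := Fin.ext (by simp at hab; omega)
            simpa [this] using hy
          | succ b =>
            simp only [Fin.cons_succ, Fin.val_succ] at hab ⊢
            rcases hab with h | h
            · exact hadj a b (by omega)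
            · exact (hadj b a (by omega)).symm
      · exact Fin.cons_injective_iff.2 ⟨hyr, hinj⟩
    · by_cases h1 : i.val + 1 = n
      · refine hmax ⟨⟨⟨Fin.snoc f y, ?_⟩, ?_⟩⟩
        · intro a b hab
          rw [SimpleGraph.pathGraph_adj] at hab
          induction a using Fin.lastCases with
          | last =>
            induction b using Fin.lastCases with
            | last => simp at hab
            | cast b =>
              have : b = i := Fin.ext (by simp at hab; omega)
              simpa [this] using hy.symm
          | cast a =>
            induction b using Fin.lastCases with
            | last =>
              have : a = i := Fin.ext (by simp at hab; omega)
              simpa [this] using hy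
            | cast b =>
              simp only [Fin.snoc_castSucc, Fin.val_castSucc] at hab ⊢
              rcases hab with h | h
              · exact hadj a b h
              · exact (hadj b a h).symm
        · exact Fin.snoc_injective_iff.2 ⟨hinj, hyr⟩
      · have hi := i.isLt
        rcases hdeg (f i) _ _ y (hadj ⟨i - 1, by omega⟩ i (by simp; omega)).symm
          (hadj i ⟨i + 1, by omega⟩ rfl) hy with h | h | h
        · have := Fin.ext_iff.1 (hinj h)
          simp only at this
          omega
        · exact hyf _ h
        · exact hyf _ h
  -- The vertices of the path are closed under adjacency, so they are all vertices.
  have hbij : Function.Bijective f :=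
    ⟨hinj, fun w => mem_of_closed hG (s := Set.range f) ⟨⟨0, hn1⟩, rfl⟩
      (by rintro _ ⟨i, rfl⟩ y hy; exact hrange i y hy) w⟩
  -- A chord can only join the two ends.
  have hchord : ∀ i j : Fin n, i < j → G.Adj (f i) (f j) → i.val + 1 = j.val ∨
      (i.val = 0 ∧ j.val + 1 = n) := by
    intro i j hij h
    have hj := j.isLt
    have hij' : i.val < j.val := hij
    by_contra! hc
    by_cases hi0 : i.val = 0
    · have := hc.2 hi0
      rcases hdeg (f j) _ _ _ (hadj ⟨j - 1, by omega⟩ j (by simp; omega)).symm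
        (hadj j ⟨j + 1, by omega⟩ rfl) h.symm with h | h | h
      all_goals
        have := Fin.ext_iff.1 (hinj h)
        simp only at this
        omega
    · rcases hdeg (f i) _ _ _ (hadj ⟨i - 1, by omega⟩ i (by simp; omega)).symm
        (hadj i ⟨i + 1, by omega⟩ rfl) h with h | h | h
      all_goals
        have := Fin.ext_iff.1 (hinj h)
        simp only at this
        omega
  by_cases hend : 3 ≤ n ∧ G.Adj (f ⟨0, hn1⟩) (f ⟨n - 1, by omega⟩)
  · refine ⟨n, Or.inr ⟨hend.1, iso_of_lt f hbij fun i j hij => ?_⟩⟩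
    rw [cycleGraph_adj_of_lt hij]
    constructor
    · intro h
      rcases hchord i j hij h with h | h
      · exact Or.inl h
      · exact Or.inr ⟨h.1, h.2, by omega⟩
    · rintro (h | ⟨h0, h1, _⟩)
      · exact hadj i j h
      · convert hend.2
        omega
  · refine ⟨n, Or.inl (iso_of_lt f hbij fun i j hij => ?_)⟩
    rw [SimpleGraph.pathGraph_adj]
    have hij' : i.val < j.val := hij
    constructor
    · intro h
      rcases hchord i j hij h with h' | h'
      · exact Or.inl h'
      · by_cases h3 : 3 ≤ n
        · refine absurd ⟨h3, ?_⟩ hend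
          convert h using 2
          · exact Fin.ext h'.1.symm
          · exact Fin.ext (by simp; omega)
        · omega
    · rintro (h | h)
      · exact hadj i j h
      · omega

end Classification

/-! ### Invariants of the connected graphs without `T_4` and `K_{1,4}` -/

section Invariants

variable {V W : Type*}

instance decidableRelS4Adj : DecidableRel S4.Adj := by unfold S4; infer_instance

instance decidableRelK4eAdj : DecidableRel K4e.Adj := by unfold K4e; infer_instance

instance decidableRelT4Adj : DecidableRel T4.Adj := by unfold T4; infer_instance

theorem two_mul_ncard_edgeSet [Fintype V] (G : SimpleGraph V) [DecidableRel G.Adj] :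
    2 * G.edgeSet.ncard = ∑ v, G.degree v := by
  classical
  rw [G.sum_degrees_eq_twice_card_edges, ← SimpleGraph.coe_edgeFinset, Set.ncard_coe_finset]

/-- A vertex of degree `d ∈ {1, 2}` is the centre of `d - 1` copies of `K_{1,2}`. -/
theorem edgeSubgraphCount_star_two_add_card [Fintype V] {G : SimpleGraph V} [DecidableRel G.Adj]
    (hG : NoIsolated G) (hdeg : ∀ v, G.degree v ≤ 2) :
    edgeSubgraphCount (Star 2) G + Fintype.card V = 2 * G.edgeSet.ncard := by
  classical
  rw [edgeSubgraphCount_star G le_rfl, ← Finset.card_univ, Finset.card_eq_sum_ones]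
  have h2 := two_mul_ncard_edgeSet G
  norm_cast
  rw [h2, ← Finset.sum_add_distrib]
  refine Finset.sum_congr rfl fun v _ => ?_
  have h1 : 0 < G.degree v := (G.degree_pos_iff_exists_adj v).2 (hG v)
  have h3 := hdeg v
  interval_cases G.degree v <;> rfl

theorem degree_path_le (n : ℕ) [DecidableRel (P n).Adj] (v : Fin n) : (P n).degree v ≤ 2 := by
  have : ((P n).neighborFinset v).map Fin.valEmbedding ⊆ {v.val - 1, v.val + 1} := by
    intro x hx
    obtain ⟨w, hw, rfl⟩ := Finset.mem_map.1 hx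
    rw [SimpleGraph.mem_neighborFinset, SimpleGraph.pathGraph_adj] at hw
    simp only [Fin.valEmbedding_apply, Finset.mem_insert, Finset.mem_singleton]
    omega
  have h := (Finset.card_le_card this).trans Finset.card_le_two
  rwa [Finset.card_map] at h

theorem degree_cycle {n : ℕ} (hn : 3 ≤ n) [DecidableRel (C n).Adj] (v : Fin n) :
    (C n).degree v = 2 := by
  obtain ⟨k, rfl⟩ : ∃ k, n = k + 3 := ⟨n - 3, by omega⟩
  rw [← SimpleGraph.cycleGraph_degree_three_le (v := v)]
  convert rfl

theorem ncard_edgeSet_path (n : ℕ) : (P (n + 1)).edgeSet.ncard = n := by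
  have h : (P (n + 1)).edgeSet = (fun i : Fin n => s(i.castSucc, i.succ)) '' Set.univ := by
    ext e
    induction e with
    | _ a b =>
      rw [SimpleGraph.mem_edgeSet, SimpleGraph.pathGraph_adj]
      simp only [Set.image_univ, Set.mem_range, Sym2.eq_iff, Fin.ext_iff, Fin.val_castSucc,
        Fin.val_succ]
      constructor
      · rintro (h | h)
        · exact ⟨⟨a, by omega⟩, Or.inl ⟨rfl, h⟩⟩
        · exact ⟨⟨b, by omega⟩, Or.inr ⟨rfl, h⟩⟩
      · rintro ⟨i, h | h⟩ <;> omega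
  rw [h, Set.ncard_image_of_injective, Set.ncard_univ, Nat.card_fin]
  intro i j hij
  simp only [Sym2.eq_iff, Fin.ext_iff, Fin.val_castSucc, Fin.val_succ] at hij
  exact Fin.ext (by omega)

theorem ncard_edgeSet_cycle {n : ℕ} (hn : 3 ≤ n) : (C n).edgeSet.ncard = n := by
  have h := two_mul_ncard_edgeSet (C n)
  simp only [degree_cycle hn, Finset.sum_const, Finset.card_univ, Fintype.card_fin,
    smul_eq_mul] at h
  omega

theorem noIsolated_path {n : ℕ} (hn : 2 ≤ n) : NoIsolated (P n) := by
  have : Nontrivial (Fin n) := Fin.nontrivial_iff_two_le.2 hn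
  exact fun v => (SimpleGraph.pathGraph_preconnected n).exists_adj_of_nontrivial v

theorem noIsolated_cycle {n : ℕ} (hn : 2 ≤ n) : NoIsolated (C n) := by
  have : Nontrivial (Fin n) := Fin.nontrivial_iff_two_le.2 hn
  exact fun v => SimpleGraph.cycleGraph_preconnected.exists_adj_of_nontrivial v

theorem edgeSubgraphCount_star_two_path {n : ℕ} (hn : 2 ≤ n) :
    edgeSubgraphCount (Star 2) (P n) + 2 = n := by
  classical
  have h := edgeSubgraphCount_star_two_add_card (noIsolated_path hn) (degree_path_le n)
  obtain ⟨k, rfl⟩ : ∃ k, n = k + 1 := ⟨n - 1, by omega⟩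
  rw [ncard_edgeSet_path, Fintype.card_fin] at h
  push_cast at h ⊢
  omega

theorem edgeSubgraphCount_star_two_cycle {n : ℕ} (hn : 3 ≤ n) :
    edgeSubgraphCount (Star 2) (C n) = n := by
  classical
  have h := edgeSubgraphCount_star_two_add_card (noIsolated_cycle (by omega))
    (fun v => (degree_cycle hn v).le)
  rw [ncard_edgeSet_cycle hn, Fintype.card_fin] at h
  omega

theorem ncard_edgeSet_eq_card [Fintype V] [DecidableEq V] (G : SimpleGraph V)
    [DecidableRel G.Adj] : G.edgeSet.ncard = G.edgeFinset.card := by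
  rw [← SimpleGraph.coe_edgeFinset, Set.ncard_coe_finset]

theorem ncard_and_count_star_two [Fintype V] [DecidableEq V] {G : SimpleGraph V}
    [DecidableRel G.Adj] {e a : ℕ}
    (h : G.edgeFinset.card = e ∧ ∑ v, (G.degree v).choose 2 = a) :
    G.edgeSet.ncard = e ∧ edgeSubgraphCount (Star 2) G = a := by
  rw [ncard_edgeSet_eq_card, edgeSubgraphCount_star G le_rfl]
  exact_mod_cast h

/-- Connected graphs without `T_4` and `K_{1,4}`, with the numbers of edges and of pairs of
adjacent edges. -/
theorem exists_iso_of_isThin [Finite V] {G : SimpleGraph V} (hG : G.Connected)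
    (he : G.edgeSet.Nonempty) (hthin : IsThin G) :
    (∃ n, 2 ≤ n ∧ Nonempty (G ≃g P n) ∧ G.edgeSet.ncard + 1 = n ∧
      edgeSubgraphCount (Star 2) G + 2 = n) ∨
    (∃ n, 4 ≤ n ∧ Nonempty (G ≃g C n) ∧ G.edgeSet.ncard = n ∧
      edgeSubgraphCount (Star 2) G = n) ∨
    (Nonempty (G ≃g S4) ∧ G.edgeSet.ncard = 4 ∧ edgeSubgraphCount (Star 2) G = 5) ∨
    (Nonempty (G ≃g K4e) ∧ G.edgeSet.ncard = 5 ∧ edgeSubgraphCount (Star 2) G = 8) ∨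
    (Nonempty (G ≃g K 4) ∧ G.edgeSet.ncard = 6 ∧ edgeSubgraphCount (Star 2) G = 12) ∨
    ((Nonempty (G ≃g K 3) ∨ Nonempty (G ≃g Star 3)) ∧ G.edgeSet.ncard = 3 ∧
      edgeSubgraphCount (Star 2) G = 3) := by
  have inv : ∀ {U : Type} {A : SimpleGraph U}, Nonempty (G ≃g A) →
      G.edgeSet.ncard = A.edgeSet.ncard ∧
        edgeSubgraphCount (Star 2) G = edgeSubgraphCount (Star 2) A := fun ⟨φ⟩ =>
    ⟨ncard_edgeSet_congr φ, edgeSubgraphCount_congr SimpleGraph.Iso.refl φ⟩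
  by_cases hdeg : ∀ v a b c, G.Adj v a → G.Adj v b → G.Adj v c → a = b ∨ a = c ∨ b = c
  · obtain ⟨n, h | ⟨hn, h⟩⟩ := exists_iso_path_or_cycle hG hdeg
    · have hn : 2 ≤ n := by
        obtain ⟨φ⟩ := h
        obtain ⟨e, he⟩ := he
        induction e with
        | _ a b =>
          have : φ a ≠ φ b := fun h => SimpleGraph.Adj.ne he (φ.injective h)
          omega
      have h1 := inv h
      obtain ⟨k, rfl⟩ : ∃ k, n = k + 1 := ⟨n - 1, by omega⟩
      rw [ncard_edgeSet_path] at h1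
      refine Or.inl ⟨k + 1, hn, h, by omega, ?_⟩
      rw [h1.2, edgeSubgraphCount_star_two_path hn]
    · have h1 := inv h
      rw [ncard_edgeSet_cycle hn, edgeSubgraphCount_star_two_cycle hn] at h1
      by_cases h4 : 4 ≤ n
      · exact Or.inr (Or.inl ⟨n, h4, h, h1⟩)
      · obtain rfl : n = 3 := by omega
        refine Or.inr (Or.inr (Or.inr (Or.inr (Or.inr ⟨Or.inl ?_, h1⟩))))
        have : C 3 = K 3 := SimpleGraph.cycleGraph_three_eq_top
        rwa [← this]
  · push Not at hdeg
    obtain ⟨v, a, b, c, ha, hb, hc, hab, hac, hbc⟩ := hdeg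
    rcases exists_iso_of_three_neighbors hG hthin ha hb hc hab hac hbc with h | h | h | h
    · have h1 := inv h
      have h2 := ncard_and_count_star_two (G := Star 3) (e := 3) (a := 3) (by decide)
      rw [h2.1, h2.2] at h1
      exact Or.inr (Or.inr (Or.inr (Or.inr (Or.inr ⟨Or.inr h, h1⟩))))
    · have h1 := inv h
      have h2 := ncard_and_count_star_two (G := S4) (e := 4) (a := 5) (by decide)
      rw [h2.1, h2.2] at h1
      exact Or.inr (Or.inr (Or.inl ⟨h, h1⟩))
    · have h1 := inv h
      have h2 := ncard_and_count_star_two (G := K4e) (e := 5) (a := 8) (by decide)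
      rw [h2.1, h2.2] at h1
      exact Or.inr (Or.inr (Or.inr (Or.inl ⟨h, h1⟩)))
    · have h1 := inv h
      have h2 := ncard_and_count_star_two (G := K 4) (e := 6) (a := 12) (by decide)
      rw [h2.1, h2.2] at h1
      exact Or.inr (Or.inr (Or.inr (Or.inr (Or.inl ⟨h, h1⟩))))

/-- The numbers of edges and of pairs of adjacent edges separate the connected graphs without
`T_4` and `K_{1,4}`, except for the pair `K_3`, `K_{1,3}`. -/
theorem iso_of_isThin_of_eq [Finite V] [Finite W] {G : SimpleGraph V} {H : SimpleGraph W}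
    (hG : G.Connected) (hH : H.Connected) (heG : G.edgeSet.Nonempty) (heH : H.edgeSet.Nonempty)
    (htG : IsThin G) (htH : IsThin H) (he : G.edgeSet.ncard = H.edgeSet.ncard)
    (ha : edgeSubgraphCount (Star 2) G = edgeSubgraphCount (Star 2) H) :
    Nonempty (G ≃g H) ∨ ((Nonempty (G ≃g K 3) ∨ Nonempty (G ≃g Star 3)) ∧
      (Nonempty (H ≃g K 3) ∨ Nonempty (H ≃g Star 3))) := by
  rcases exists_iso_of_isThin hG heG htG with
    ⟨n, -, ⟨φ⟩, h1, h2⟩ | ⟨n, hn, ⟨φ⟩, h1, h2⟩ | ⟨⟨φ⟩, h1, h2⟩ | ⟨⟨φ⟩, h1, h2⟩ | ⟨⟨φ⟩, h1, h2⟩ |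
      ⟨h, h1, h2⟩ <;>
  rcases exists_iso_of_isThin hH heH htH with
    ⟨m, -, ⟨ψ⟩, h3, h4⟩ | ⟨m, hm, ⟨ψ⟩, h3, h4⟩ | ⟨⟨ψ⟩, h3, h4⟩ | ⟨⟨ψ⟩, h3, h4⟩ | ⟨⟨ψ⟩, h3, h4⟩ |
      ⟨h', h3, h4⟩ <;>
  first
  | (exfalso; omega)
  | (obtain rfl : n = m := by omega
     exact Or.inl ⟨φ.trans ψ.symm⟩)
  | exact Or.inl ⟨φ.trans ψ.symm⟩
  | exact Or.inr ⟨h, h'⟩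

/-- Paths, cycles of length at least four, `S_4`, `K_4 \ e` and `K_4` have as many triangles as
claws. -/
theorem edgeSubgraphCount_K3_eq_star_of_isThin [Finite V] {G : SimpleGraph V} (hG : G.Connected)
    (he : G.edgeSet.Nonempty) (hthin : IsThin G) (h3 : ¬ Nonempty (G ≃g K 3))
    (h3' : ¬ Nonempty (G ≃g Star 3)) :
    edgeSubgraphCount (K 3) G = edgeSubgraphCount (Star 3) G := by
  classical
  have inv : ∀ {U : Type} {A : SimpleGraph U}, Nonempty (G ≃g A) →
      edgeSubgraphCount (K 3) A = edgeSubgraphCount (Star 3) A →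
        edgeSubgraphCount (K 3) G = edgeSubgraphCount (Star 3) G := fun ⟨φ⟩ h =>
    (edgeSubgraphCount_congr SimpleGraph.Iso.refl φ).trans
      (h.trans (edgeSubgraphCount_congr SimpleGraph.Iso.refl φ).symm)
  have zero : ∀ {U : Type} [Fintype U] [DecidableEq U] {A : SimpleGraph U}
      [DecidableRel A.Adj], A.CliqueFree 3 →
      (∀ v, A.degree v ≤ 2) → edgeSubgraphCount (K 3) A = edgeSubgraphCount (Star 3) A := by
    intro U _ _ A _ hc hd
    rw [edgeSubgraphCount_K A (by norm_num), edgeSubgraphCount_star A (by norm_num),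
      SimpleGraph.cliqueFinset_eq_empty_iff.2 hc, Finset.card_empty, Finset.sum_eq_zero]
    intro v _
    exact Nat.choose_eq_zero_of_lt (Nat.lt_succ_of_le (hd v))
  rcases exists_iso_of_isThin hG he hthin with
    ⟨n, hn, h, h1, h2⟩ | ⟨n, hn, h, h1, h2⟩ | ⟨h, h1, h2⟩ | ⟨h, h1, h2⟩ | ⟨h, h1, h2⟩ |
      ⟨h, h1, h2⟩
  · exact inv h (zero SimpleGraph.cliqueFree_hasse_three (degree_path_le n))
  · refine inv h (zero ?_ (fun v => (degree_cycle (by omega) v).le))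
    have tri : ∀ i j k : Fin n, i < j → j < k → (C n).Adj i j → (C n).Adj j k →
        (C n).Adj i k → False := by
      intro i j k hij hjk h1 h2 h3
      rw [cycleGraph_adj_of_lt hij] at h1
      rw [cycleGraph_adj_of_lt hjk] at h2
      rw [cycleGraph_adj_of_lt (hij.trans hjk)] at h3
      omega
    intro s hs
    obtain ⟨a, b, c, hab, hac, hbc, -⟩ := SimpleGraph.is3Clique_iff.1 hs
    rcases lt_or_gt_of_ne hab.ne with h1 | h1 <;> rcases lt_or_gt_of_ne hac.ne with h2 | h2 <;>
      rcases lt_or_gt_of_ne hbc.ne with h3 | h3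
    · exact tri a b c h1 h3 hab hbc hac
    · exact tri a c b h2 h3 hac hbc.symm hab
    · exact absurd (h1.trans h3) (not_lt_of_gt h2)
    · exact tri c a b h2 h1 hac.symm hab hbc.symm
    · exact tri b a c h1 h2 hab.symm hac hbc
    · exact absurd (h3.trans h1) (not_lt_of_gt h2)
    · exact tri b c a h3 h2 hbc hac.symm hab.symm
    · exact tri c b a h3 h1 hbc.symm hab.symm hac.symm
  · refine inv h ?_
    rw [edgeSubgraphCount_K _ (by norm_num), edgeSubgraphCount_star _ (by norm_num)]
    decide
  · refine inv h ?_
    rw [edgeSubgraphCount_K _ (by norm_num), edgeSubgraphCount_star _ (by norm_num)]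
    decide
  · refine inv h ?_
    rw [edgeSubgraphCount_K _ (by norm_num), edgeSubgraphCount_star _ (by norm_num)]
    decide
  · rcases h with h | h
    · exact absurd h h3
    · exact absurd h h3'

end Invariants

/-! ### Graphs with few adjacent pairs of edges -/

section Disjoint

variable {V W : Type*}

/-- Graphs without isolated vertices and without adjacent edges are determined by the number of
edges, since their only connected subgraph with an edge is `K_2`. -/
theorem iso_of_edgeSubgraphCount_star_two_eq_zero [Finite V] [Finite W] {G : SimpleGraph V}
    {H : SimpleGraph W} (hG : NoIsolated G) (hH : NoIsolated H)
    (haG : edgeSubgraphCount (Star 2) G = 0) (haH : edgeSubgraphCount (Star 2) H = 0)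
    (he : G.edgeSet.ncard = H.edgeSet.ncard) : Nonempty (G ≃g H) := by
  refine iso_of_edgeSubgraphCount_connected hG hH fun n T hT hTe => ?_
  have hpos : 0 < T.edgeSet.ncard := (Set.ncard_pos (Set.toFinite _)).2 hTe
  by_cases h1 : T.edgeSet.ncard = 1
  · obtain ⟨φ⟩ := iso_K2_of_ncard_eq_one (noIsolated_of_connected hT hTe) h1
    rw [edgeSubgraphCount_congr φ SimpleGraph.Iso.refl (G := G),
      edgeSubgraphCount_congr φ SimpleGraph.Iso.refl (G := H), edgeSubgraphCount_K2,
      edgeSubgraphCount_K2, he]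
  · obtain ⟨m, S, hS, -, -, hlt⟩ := exists_connected_isEdgeSubgraph hT (by omega)
    have hS0 : 0 ≤ edgeSubgraphCount (Star 2) S := Int.natCast_nonneg _
    have hstar : IsEdgeSubgraph (Star 2) T := edgeSubgraphCount_ne_zero_iff.1 (by omega)
    rw [edgeSubgraphCount_eq_zero_iff.2 fun h =>
        edgeSubgraphCount_eq_zero_iff.1 haG (hstar.trans h),
      edgeSubgraphCount_eq_zero_iff.2 fun h =>
        edgeSubgraphCount_eq_zero_iff.1 haH (hstar.trans h)]

/-- If `A` consists of two disjoint edges, its copies are the pairs of disjoint edges. -/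
theorem mem_copiesIn_two_disjoint_iff [Finite V] [Finite W] {A : SimpleGraph W}
    (hA : NoIsolated A) (hAe : A.edgeSet.ncard = 2) (hAa : edgeSubgraphCount (Star 2) A = 0)
    {G : SimpleGraph V} {E : Set (Sym2 V)} :
    E ∈ copiesIn A G.edgeSet ↔ ∃ p q r s, G.Adj p q ∧ G.Adj r s ∧ p ≠ r ∧ p ≠ s ∧ q ≠ r ∧ q ≠ s ∧
      E = {s(p, q), s(r, s)} := by
  constructor
  · rintro ⟨hE, ⟨θ⟩⟩
    have h2 := ncard_edgeSet_congr θ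
    rw [ncard_edgeSet_edgeInduced hE, hAe] at h2
    obtain ⟨e, f, hef, rfl⟩ := Set.ncard_eq_two.1 h2
    have hno : ∀ w u v, e = s(w, u) → f = s(w, v) → False := by
      rintro w u v rfl rfl
      have h3 : ({s(w, u), s(w, v)} : Set (Sym2 V)) ∈ copiesIn (Star 2) G.edgeSet :=
        mem_copiesIn_star_two_iff.2 ⟨w, u, v, hE (Or.inl rfl), hE (Or.inr rfl),
          fun h => hef (by rw [h]), rfl⟩
      obtain ⟨-, ⟨ψ⟩⟩ := h3
      have := edgeSubgraphCount_self hA (θ.symm.trans ψ)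
      omega
    induction e with
    | _ p q =>
      induction f with
      | _ r s =>
        refine ⟨p, q, r, s, hE (Or.inl rfl), hE (Or.inr rfl), ?_, ?_, ?_, ?_, rfl⟩
        · rintro rfl
          exact hno p q s rfl rfl
        · rintro rfl
          exact hno p q r rfl Sym2.eq_swap
        · rintro rfl
          exact hno q p s Sym2.eq_swap rfl
        · rintro rfl
          exact hno q p r Sym2.eq_swap Sym2.eq_swap
  · rintro ⟨p, q, r, s, hpq, hrs, h1, h2, h3, h4, rfl⟩
    have hE : {s(p, q), s(r, s)} ⊆ G.edgeSet := by
      rintro e (rfl | rfl)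
      · exact hpq
      · exact hrs
    refine ⟨hE, iso_of_edgeSubgraphCount_star_two_eq_zero (noIsolated_edgeInduced hE) hA ?_ hAa ?_⟩
    · rw [edgeSubgraphCount_edgeInduced hE, Nat.cast_eq_zero, Set.ncard_eq_zero (Set.toFinite _),
        Set.eq_empty_iff_forall_notMem]
      intro E' hE'
      obtain ⟨w, u, v, -, -, huv, rfl⟩ :=
        mem_copiesIn_star_two_iff.1 (copiesIn_mono _ hE hE')
      have hu := hE'.1 (show s(w, u) ∈ _ by simp)
      have hv := hE'.1 (show s(w, v) ∈ _ by simp)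
      simp only [Set.mem_insert_iff, Set.mem_singleton_iff, Sym2.eq_iff] at hu hv
      grind
    · rw [ncard_edgeSet_edgeInduced hE, hAe, Set.ncard_pair]
      intro h
      rw [Sym2.eq_iff] at h
      tauto

theorem edgeSubgraphCount_two_disjoint_K3 [Finite W] {A : SimpleGraph W}
    (hA : NoIsolated A) (hAe : A.edgeSet.ncard = 2) (hAa : edgeSubgraphCount (Star 2) A = 0) :
    edgeSubgraphCount A (K 3) = 0 := by
  rw [edgeSubgraphCount_eq_ncard, Nat.cast_eq_zero, Set.ncard_eq_zero (Set.toFinite _),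
    Set.eq_empty_iff_forall_notMem]
  intro E hE
  obtain ⟨p, q, r, s, hpq, hrs, h1, h2, h3, h4, -⟩ :=
    (mem_copiesIn_two_disjoint_iff hA hAe hAa).1 hE
  have h5 : p ≠ q := hpq
  have h6 : r ≠ s := hrs
  omega

theorem edgeSubgraphCount_two_disjoint_star [Finite W] {A : SimpleGraph W}
    (hA : NoIsolated A) (hAe : A.edgeSet.ncard = 2) (hAa : edgeSubgraphCount (Star 2) A = 0)
    (m : ℕ) : edgeSubgraphCount A (Star m) = 0 := by
  rw [edgeSubgraphCount_eq_ncard, Nat.cast_eq_zero, Set.ncard_eq_zero (Set.toFinite _),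
    Set.eq_empty_iff_forall_notMem]
  intro E hE
  obtain ⟨p, q, r, s, hpq, hrs, h1, h2, h3, h4, -⟩ :=
    (mem_copiesIn_two_disjoint_iff hA hAe hAa).1 hE
  have center : ∀ x y, (Star m).Adj x y → x = Sum.inl 0 ∨ y = Sum.inl 0 := by
    rintro (x | x) (y | y) h
    · simp at h
    · exact Or.inl (by rw [Subsingleton.elim x 0])
    · exact Or.inr (by rw [Subsingleton.elim y 0])
    · simp at h
  rcases center p q hpq with rfl | rfl <;> rcases center r s hrs with rfl | rfl <;> simp_all

theorem isContained_K3 {G : SimpleGraph V} {a b c : V} (hab : G.Adj a b) (hac : G.Adj a c)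
    (hbc : G.Adj b c) : (K 3).IsContained G := by
  refine ⟨⟨⟨![a, b, c], ?_⟩, ?_⟩⟩
  · intro i j h
    fin_cases i <;> fin_cases j <;> simp_all [SimpleGraph.adj_comm]
  · intro i j h
    have := hab.ne
    have := hac.ne
    have := hbc.ne
    fin_cases i <;> fin_cases j <;> simp_all

theorem isContained_star_three {G : SimpleGraph V} {v a b c : V} (ha : G.Adj v a)
    (hb : G.Adj v b) (hc : G.Adj v c) (hab : a ≠ b) (hac : a ≠ c) (hbc : b ≠ c) :
    (Star 3).IsContained G := by
  refine ⟨⟨⟨Sum.elim (fun _ => v) ![a, b, c], ?_⟩, ?_⟩⟩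
  · rintro (i | i) (j | j) h
    · simp at h
    · fin_cases j <;> simpa
    · fin_cases i <;> simp [ha.symm, hb.symm, hc.symm]
    · simp at h
  · have h1 := ha.ne
    have h2 := hb.ne
    have h3 := hc.ne
    rintro (i | i) (j | j) h
    · rw [Subsingleton.elim i j]
    · fin_cases j <;> simp_all
    · fin_cases i <;> simp_all
    · fin_cases i <;> fin_cases j <;> simp_all

/-- Four edges with exactly one pair of disjoint edges form `S_4`, which contains both a triangle
and a claw. -/
theorem isContained_K3_and_star_three [Finite V] [Finite W] {A : SimpleGraph W}
    (hA : NoIsolated A) (hAe : A.edgeSet.ncard = 2) (hAa : edgeSubgraphCount (Star 2) A = 0)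
    {G : SimpleGraph V} (he : G.edgeSet.ncard = 4) (h : edgeSubgraphCount A G = 1) :
    (K 3).IsContained G ∧ (Star 3).IsContained G := by
  rw [edgeSubgraphCount_eq_ncard, Nat.cast_eq_one] at h
  obtain ⟨E, hE⟩ := Set.ncard_eq_one.1 h
  have hmem : E ∈ copiesIn A G.edgeSet := by
    rw [hE]
    rfl
  obtain ⟨p, q, r, s, hpq, hrs, h1, h2, h3, h4, rfl⟩ :=
    (mem_copiesIn_two_disjoint_iff hA hAe hAa).1 hmem
  have huniq : ∀ x y z w, G.Adj x y → G.Adj z w → x ≠ z → x ≠ w → y ≠ z → y ≠ w →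
      s(x, y) = s(p, q) ∨ s(x, y) = s(r, s) := by
    intro x y z w hxy hzw h1 h2 h3 h4
    have h5 : ({s(x, y), s(z, w)} : Set (Sym2 V)) ∈ copiesIn A G.edgeSet :=
      (mem_copiesIn_two_disjoint_iff hA hAe hAa).2 ⟨x, y, z, w, hxy, hzw, h1, h2, h3, h4, rfl⟩
    rw [hE, Set.mem_singleton_iff] at h5
    have h6 : s(x, y) ∈ ({s(p, q), s(r, s)} : Set (Sym2 V)) := by
      rw [← h5]
      simp
    simpa using h6
  have hrest : 1 < (G.edgeSet \ {s(p, q), s(r, s)}).ncard := by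
    have h5 := Set.ncard_sdiff_add_ncard_of_subset hmem.1
    have h6 : ({s(p, q), s(r, s)} : Set (Sym2 V)).ncard = 2 := by
      refine Set.ncard_pair fun h => ?_
      rw [Sym2.eq_iff] at h
      tauto
    omega
  obtain ⟨e, f, heE, hfE, hef⟩ := (Set.one_lt_ncard_iff (Set.toFinite _)).1 hrest
  -- Any further edge joins an end of `pq` to an end of `rs`.
  have hjoin : ∀ e ∈ G.edgeSet \ {s(p, q), s(r, s)},
      e = s(p, r) ∨ e = s(p, s) ∨ e = s(q, r) ∨ e = s(q, s) := by
    rintro e ⟨heG, heE⟩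
    induction e with
    | _ x y =>
      simp only [Set.mem_insert_iff, Set.mem_singleton_iff] at heE
      have hx1 : x = p ∨ x = q ∨ y = p ∨ y = q := by
        by_contra! hc
        exact heE (huniq x y p q heG hpq hc.1 hc.2.1 hc.2.2.1 hc.2.2.2)
      have hx2 : x = r ∨ x = s ∨ y = r ∨ y = s := by
        by_contra! hc
        exact heE (huniq x y r s heG hrs hc.1 hc.2.1 hc.2.2.1 hc.2.2.2)
      simp only [Sym2.eq_iff]
      grind
  have final : ∀ x y z w : V, G.Adj x y → G.Adj z w → x ≠ z → x ≠ w → y ≠ z → y ≠ w →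
      G.Adj x z → G.Adj x w → (K 3).IsContained G ∧ (Star 3).IsContained G := by
    intro x y z w hxy hzw h1 h2 h3 h4 h5 h6
    exact ⟨isContained_K3 h5 h6 hzw, isContained_star_three hxy h5 h6 h3 h4 hzw.ne⟩
  have heG := heE.1
  have hfG := hfE.1
  have hfE2 := hfE.2
  simp only [Set.mem_insert_iff, Set.mem_singleton_iff, not_or] at hfE2
  rcases hjoin e heE with rfl | rfl | rfl | rfl <;> rcases hjoin f hfE with rfl | rfl | rfl | rfl
  · exact absurd rfl hef
  · exact final p q r s hpq hrs h1 h2 h3 h4 heG hfG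
  · exact final r s p q hrs hpq h1.symm h3.symm h2.symm h4.symm heG.symm hfG.symm
  · rcases huniq q s p r hfG heG hpq.ne' h3 h2.symm hrs.ne' with h | h
    · exact absurd h hfE2.1
    · exact absurd h hfE2.2
  · exact final p q r s hpq hrs h1 h2 h3 h4 hfG heG
  · exact absurd rfl hef
  · rcases huniq q r p s hfG heG hpq.ne' h4 h1.symm hrs.ne with h | h
    · exact absurd h hfE2.1
    · exact absurd h hfE2.2
  · exact final s r p q hrs.symm hpq h2.symm h4.symm h1.symm h3.symm heG.symm hfG.symm
  · exact final r s p q hrs hpq h1.symm h3.symm h2.symm h4.symm hfG.symm heG.symm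
  · rcases huniq p s q r hfG heG hpq.ne h1 h4.symm hrs.ne' with h | h
    · exact absurd h hfE2.1
    · exact absurd h hfE2.2
  · exact absurd rfl hef
  · exact final q p r s hpq.symm hrs h3 h4 h1 h2 heG hfG
  · rcases huniq p r q s hfG heG hpq.ne h2 h3.symm hrs.ne with h | h
    · exact absurd h hfE2.1
    · exact absurd h hfE2.2
  · exact final s r p q hrs.symm hpq h2.symm h4.symm h1.symm h3.symm hfG.symm heG.symm
  · exact final q p r s hpq.symm hrs h3 h4 h1 h2 hfG heG
  · exact absurd rfl hef

end Disjoint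

/-! ### Isomorphisms of weighted edge-subgraph posets -/

namespace UnlabelledGraph

instance decidableRelSumAdj {V W : Type*} (G : SimpleGraph V) (H : SimpleGraph W)
    [DecidableRel G.Adj] [DecidableRel H.Adj] : DecidableRel (G ⊕g H).Adj
  | .inl a, .inl b => inferInstanceAs (Decidable (G.Adj a b))
  | .inr a, .inr b => inferInstanceAs (Decidable (H.Adj a b))
  | .inl _, .inr _ => isFalse (by simp)
  | .inr _, .inl _ => isFalse (by simp)

instance decidableRelBoxProdAdj {V W : Type*} [DecidableEq V] [DecidableEq W]
    (G : SimpleGraph V) (H : SimpleGraph W) [DecidableRel G.Adj] [DecidableRel H.Adj] :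
    DecidableRel (G □ H).Adj := fun x y =>
  inferInstanceAs (Decidable (G.Adj x.1 y.1 ∧ x.2 = y.2 ∨ H.Adj x.2 y.2 ∧ x.1 = y.1))

/-- The number of pairs of adjacent edges, that is, of copies of `K_{1,2}`. -/
noncomputable def adjPairs (x : UnlabelledGraph) : ℤ := q (unlabelled (Star 2)) x

/-- Connectedness of an unlabelled graph. -/
def Conn (x : UnlabelledGraph) : Prop :=
  ∃ (n : ℕ) (A : SimpleGraph (Fin n)), x = unlabelled A ∧ A.Connected

/-- The unlabelled graph contains neither `T_4` nor `K_{1,4}`. -/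
def Thin (x : UnlabelledGraph) : Prop :=
  ¬ EdgeLE (unlabelled T4) x ∧ ¬ EdgeLE (unlabelled (Star 4)) x

section Classes

variable {V W : Type*} [Finite V] [Finite W] {x y z : UnlabelledGraph}

theorem conn_unlabelled {G : SimpleGraph V} : Conn (unlabelled G) ↔ G.Connected := by
  constructor
  · rintro ⟨n, A, h, hA⟩
    obtain ⟨φ⟩ := (unlabelled_eq_iff _ _).1 h
    exact φ.connected_iff.2 hA
  · intro h
    obtain ⟨n, A, hA⟩ := exists_rep (unlabelled G)
    obtain ⟨φ⟩ := (unlabelled_eq_iff _ _).1 hA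
    exact ⟨n, A, hA, φ.connected_iff.1 h⟩

theorem adjPairs_unlabelled (G : SimpleGraph V) :
    adjPairs (unlabelled G) = edgeSubgraphCount (Star 2) G := q_unlabelled _ _

theorem noIsolated_T4 : NoIsolated T4 := by
  unfold NoIsolated
  decide

theorem thin_unlabelled {G : SimpleGraph V} : Thin (unlabelled G) ↔ IsThin G := by
  rw [Thin, IsThin, edgeLE_unlabelled, edgeLE_unlabelled, isEdgeSubgraph_iff, isEdgeSubgraph_iff]
  simp [noIsolated_T4, noIsolated_star]

theorem edgeLE_self_unlabelled {G : SimpleGraph V} :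
    EdgeLE (unlabelled G) (unlabelled G) ↔ NoIsolated G := by
  rw [edgeLE_unlabelled, isEdgeSubgraph_iff]
  exact ⟨fun h => h.1, fun h => ⟨h, SimpleGraph.IsContained.rfl⟩⟩

theorem EdgeLE.trans (hxy : EdgeLE x y) (hyz : EdgeLE y z) : EdgeLE x z := by
  obtain ⟨_, A, rfl⟩ := exists_rep x
  obtain ⟨_, B, rfl⟩ := exists_rep y
  obtain ⟨_, D, rfl⟩ := exists_rep z
  rw [edgeLE_unlabelled] at *
  exact IsEdgeSubgraph.trans hxy hyz

theorem EdgeLE.self (hxy : EdgeLE x y) : EdgeLE x x := by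
  obtain ⟨_, A, rfl⟩ := exists_rep x
  obtain ⟨_, B, rfl⟩ := exists_rep y
  rw [edgeLE_unlabelled, isEdgeSubgraph_iff] at *
  exact ⟨hxy.1, SimpleGraph.IsContained.rfl⟩

theorem EdgeLE.numEdges_le (hxy : EdgeLE x y) : numEdges x ≤ numEdges y := by
  obtain ⟨_, A, rfl⟩ := exists_rep x
  obtain ⟨_, B, rfl⟩ := exists_rep y
  rw [edgeLE_unlabelled] at hxy
  rw [numEdges_unlabelled, numEdges_unlabelled]
  exact IsEdgeSubgraph.ncard_edgeSet_le hxy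

theorem EdgeLE.eq_of_numEdges_le (hxy : EdgeLE x y) (hy : EdgeLE y y)
    (h : numEdges y ≤ numEdges x) : x = y := by
  obtain ⟨_, A, rfl⟩ := exists_rep x
  obtain ⟨_, B, rfl⟩ := exists_rep y
  rw [numEdges_unlabelled, numEdges_unlabelled] at h
  rw [edgeLE_self_unlabelled] at hy
  rw [edgeLE_unlabelled] at hxy
  exact (unlabelled_eq_iff _ _).2 (IsEdgeSubgraph.iso_of_ncard_le hxy hy h)

theorem q_ne_zero_iff : q x y ≠ 0 ↔ EdgeLE x y := by
  obtain ⟨_, A, rfl⟩ := exists_rep x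
  obtain ⟨_, B, rfl⟩ := exists_rep y
  rw [q_unlabelled, edgeLE_unlabelled, edgeSubgraphCount_ne_zero_iff]

theorem q_eq_zero_iff : q x y = 0 ↔ ¬ EdgeLE x y := by
  rw [← q_ne_zero_iff, not_not]

theorem q_K2 (x : UnlabelledGraph) : q (unlabelled (K 2)) x = numEdges x := by
  obtain ⟨_, A, rfl⟩ := exists_rep x
  rw [q_unlabelled, numEdges_unlabelled, edgeSubgraphCount_K2]

theorem numEdges_K2 : numEdges (unlabelled (K 2)) = 1 := by
  rw [numEdges_unlabelled, ncard_edgeSet_K2]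

theorem K2_edgeLE (hx : 0 < numEdges x) : EdgeLE (unlabelled (K 2)) x := by
  rw [← q_ne_zero_iff, q_K2]
  omega

theorem eq_of_adjPairs_eq_zero (hx : EdgeLE x x) (hy : EdgeLE y y) (hax : adjPairs x = 0)
    (hay : adjPairs y = 0) (he : numEdges x = numEdges y) : x = y := by
  obtain ⟨_, A, rfl⟩ := exists_rep x
  obtain ⟨_, B, rfl⟩ := exists_rep y
  rw [numEdges_unlabelled, numEdges_unlabelled] at he
  rw [edgeLE_self_unlabelled] at hx hy
  rw [adjPairs_unlabelled] at hax hay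
  exact (unlabelled_eq_iff _ _).2 (iso_of_edgeSubgraphCount_star_two_eq_zero hx hy hax hay he)

theorem Conn.exists_edgeLE (hx : Conn x) (he : 2 ≤ numEdges x) :
    ∃ y, EdgeLE y x ∧ Conn y ∧ numEdges y + 1 = numEdges x ∧ adjPairs y < adjPairs x := by
  obtain ⟨n, A, rfl⟩ := exists_rep x
  rw [conn_unlabelled] at hx
  rw [numEdges_unlabelled] at he
  obtain ⟨m, T, h1, h2, h3, h4⟩ := exists_connected_isEdgeSubgraph hx he
  refine ⟨unlabelled T, edgeLE_unlabelled.2 h1, conn_unlabelled.2 h2, ?_, ?_⟩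
  · rw [numEdges_unlabelled, numEdges_unlabelled, h3]
  · rwa [adjPairs_unlabelled, adjPairs_unlabelled]

theorem Conn.of_edgeLE (hx : EdgeLE x x) (hy : Conn y) (hyx : EdgeLE y x)
    (he : numEdges y + 1 = numEdges x) (ha : adjPairs y < adjPairs x) : Conn x := by
  obtain ⟨_, A, rfl⟩ := exists_rep x
  obtain ⟨_, B, rfl⟩ := exists_rep y
  rw [conn_unlabelled] at *
  rw [edgeLE_unlabelled] at hyx
  rw [edgeLE_self_unlabelled] at hx
  rw [numEdges_unlabelled, numEdges_unlabelled] at he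
  rw [adjPairs_unlabelled, adjPairs_unlabelled] at ha
  exact connected_of_isEdgeSubgraph hx hy hyx he ha

theorem edgeSet_nonempty_of_numEdges {G : SimpleGraph V} (h : 0 < numEdges (unlabelled G)) :
    G.edgeSet.Nonempty := by
  rw [numEdges_unlabelled] at h
  exact (Set.ncard_pos (Set.toFinite _)).1 h

theorem eq_or_of_thin (hx : Conn x) (hy : Conn y) (hex : 0 < numEdges x)
    (htx : Thin x) (hty : Thin y) (he : numEdges x = numEdges y) (ha : adjPairs x = adjPairs y) :
    x = y ∨ ((x = unlabelled (K 3) ∨ x = unlabelled (Star 3)) ∧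
      (y = unlabelled (K 3) ∨ y = unlabelled (Star 3))) := by
  obtain ⟨_, A, rfl⟩ := exists_rep x
  obtain ⟨_, B, rfl⟩ := exists_rep y
  have hey := edgeSet_nonempty_of_numEdges (he ▸ hex)
  rw [conn_unlabelled] at *
  rw [thin_unlabelled] at *
  rw [numEdges_unlabelled, numEdges_unlabelled] at he
  rw [adjPairs_unlabelled, adjPairs_unlabelled] at ha
  simp only [unlabelled_eq_iff]
  exact iso_of_isThin_of_eq hx hy (edgeSet_nonempty_of_numEdges hex) hey htx hty he ha

theorem Thin.of_edgeLE (hy : Thin y) (hxy : EdgeLE x y) : Thin x :=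
  ⟨fun h => hy.1 (h.trans hxy), fun h => hy.2 (h.trans hxy)⟩

theorem numEdges_and_adjPairs [Fintype W] [DecidableEq W] {G : SimpleGraph W}
    [DecidableRel G.Adj] {e a : ℕ}
    (h : G.edgeFinset.card = e ∧ ∑ v, (G.degree v).choose 2 = a) :
    numEdges (unlabelled G) = e ∧ adjPairs (unlabelled G) = a := by
  rw [numEdges_unlabelled, adjPairs_unlabelled]
  exact ncard_and_count_star_two h

end Classes

section Iso

variable {g h : UnlabelledGraph}

/-- The bijection preserves the order in both directions and the weights. -/
def IsWeightedIso (f : Q g ≃ Q h) : Prop := ∀ x y : Q g,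
  (EdgeLE x.1 y.1 ↔ EdgeLE (f x).1 (f y).1) ∧ q x.1 y.1 = q (f x).1 (f y).1

variable {f : Q g ≃ Q h}

theorem IsWeightedIso.symm (hf : IsWeightedIso f) : IsWeightedIso f.symm := by
  intro x y
  have := hf (f.symm x) (f.symm y)
  rw [f.apply_symm_apply, f.apply_symm_apply] at this
  exact ⟨this.1.symm, this.2.symm⟩

/-- The least element `K_2` is fixed, and its weights are the numbers of edges. -/
theorem IsWeightedIso.numEdges_eq (hf : IsWeightedIso f) (x : Q g) :
    numEdges (f x).1 = numEdges x.1 := by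
  have hg : unlabelled (K 2) ∈ Q g :=
    ⟨(K2_edgeLE x.2.2).trans x.2.1, by rw [numEdges_K2]; exact one_pos⟩
  have hh : unlabelled (K 2) ∈ Q h :=
    ⟨(K2_edgeLE (f x).2.2).trans (f x).2.1, by rw [numEdges_K2]; exact one_pos⟩
  have hfix : (f ⟨_, hg⟩).1 = unlabelled (K 2) := by
    have h1 : EdgeLE (f ⟨_, hg⟩).1 (f (f.symm ⟨_, hh⟩)).1 :=
      (hf _ _).1.1 (K2_edgeLE (f.symm ⟨_, hh⟩).2.2)
    rw [f.apply_symm_apply] at h1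
    refine h1.eq_of_numEdges_le hh.1.self ?_
    rw [numEdges_K2]
    exact (f ⟨_, hg⟩).2.2
  have h2 := (hf ⟨_, hg⟩ x).2
  rw [hfix, q_K2, q_K2] at h2
  omega

theorem K3_ne_star_three : unlabelled (K 3) ≠ unlabelled (Star 3) := by
  rw [Ne, unlabelled_eq_iff]
  rintro ⟨φ⟩
  have := Fintype.card_congr φ.toEquiv
  simp at this

theorem numEdges_and_adjPairs_star_two_sum :
    numEdges (unlabelled (Star 2 ⊕g copies 2 (K 2))) = 4 ∧
      adjPairs (unlabelled (Star 2 ⊕g copies 2 (K 2))) = 1 := by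
  refine numEdges_and_adjPairs (G := Star 2 ⊕g copies 2 (K 2)) (e := 4) (a := 1) ?_
  decide

theorem numEdges_and_adjPairs_star_two :
    numEdges (unlabelled (Star 2)) = 2 ∧ adjPairs (unlabelled (Star 2)) = 1 :=
  numEdges_and_adjPairs (by decide)

theorem numEdges_and_adjPairs_star_three :
    numEdges (unlabelled (Star 3)) = 3 ∧ adjPairs (unlabelled (Star 3)) = 3 :=
  numEdges_and_adjPairs (by decide)

theorem numEdges_and_adjPairs_K3 :
    numEdges (unlabelled (K 3)) = 3 ∧ adjPairs (unlabelled (K 3)) = 3 :=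
  numEdges_and_adjPairs (by decide)

/-- If `K_{1,2} + 2K_2` occurs, then `K_{1,2}` is fixed. Otherwise `K_{1,2}` is sent to `2K_2`,
and `K_{1,2} + 2K_2`, with its single pair of adjacent edges, to a graph with a single pair of
disjoint edges. The latter contains `K_3` and `K_{1,3}`, while the former has only one subgraph
with three pairwise disjoint edges. -/
theorem IsWeightedIso.star_two_eq (hf : IsWeightedIso f)
    (hz : unlabelled (Star 2 ⊕g copies 2 (K 2)) ∈ Q g) (hs : unlabelled (Star 2) ∈ Q g) :
    (f ⟨_, hs⟩).1 = unlabelled (Star 2) := by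
  by_contra hne
  set x := f ⟨_, hs⟩ with hx
  set y := f ⟨_, hz⟩ with hy
  have hxe : numEdges x.1 = 2 := (hf.numEdges_eq _).trans numEdges_and_adjPairs_star_two.1
  have hye : numEdges y.1 = 4 := (hf.numEdges_eq _).trans numEdges_and_adjPairs_star_two_sum.1
  have hxa : adjPairs x.1 = 0 := by
    rw [adjPairs, q_eq_zero_iff]
    intro hle
    refine hne (hle.eq_of_numEdges_le x.2.1.self ?_).symm
    rw [hxe, numEdges_and_adjPairs_star_two.1]
  have hq : q x.1 y.1 = 1 := (hf ⟨_, hs⟩ ⟨_, hz⟩).2.symm.trans numEdges_and_adjPairs_star_two_sum.2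
  obtain ⟨n, A, hA⟩ := exists_rep x.1
  obtain ⟨m, B, hB⟩ := exists_rep y.1
  have hAI : NoIsolated A := edgeLE_self_unlabelled.1 (hA ▸ x.2.1.self)
  rw [hA, numEdges_unlabelled] at hxe
  rw [hA, adjPairs_unlabelled] at hxa
  rw [hB, numEdges_unlabelled] at hye
  rw [hA, hB, q_unlabelled] at hq
  obtain ⟨h3, hs3⟩ := isContained_K3_and_star_three hAI hxe hxa hye hq
  have hK : unlabelled (K 3) ∈ Q h := by
    refine ⟨EdgeLE.trans (y := y.1) ?_ y.2.1, by rw [numEdges_and_adjPairs_K3.1]; norm_num⟩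
    rw [hB, edgeLE_unlabelled, isEdgeSubgraph_iff]
    exact ⟨noIsolated_K (by norm_num), h3⟩
  have hS : unlabelled (Star 3) ∈ Q h := by
    refine ⟨EdgeLE.trans (y := y.1) ?_ y.2.1, by rw [numEdges_and_adjPairs_star_three.1]; norm_num⟩
    rw [hB, edgeLE_unlabelled, isEdgeSubgraph_iff]
    exact ⟨noIsolated_star (by norm_num), hs3⟩
  have ha : ∀ w : Q h, q x.1 w.1 = 0 → adjPairs (f.symm w).1 = 0 := by
    intro w hw
    have := (hf ⟨_, hs⟩ (f.symm w)).2
    rw [f.apply_symm_apply] at this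
    exact this.trans hw
  have heq : (f.symm ⟨_, hK⟩).1 = (f.symm ⟨_, hS⟩).1 := by
    refine eq_of_adjPairs_eq_zero (f.symm _).2.1.self (f.symm _).2.1.self (ha _ ?_) (ha _ ?_) ?_
    · rw [hA, q_unlabelled]
      exact edgeSubgraphCount_two_disjoint_K3 hAI hxe hxa
    · rw [hA, q_unlabelled]
      exact edgeSubgraphCount_two_disjoint_star hAI hxe hxa 3
    · rw [hf.symm.numEdges_eq, hf.symm.numEdges_eq, numEdges_and_adjPairs_K3.1,
        numEdges_and_adjPairs_star_three.1]
  exact K3_ne_star_three (Subtype.ext_iff.1 (f.symm.injective (Subtype.ext heq)))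

/-- A weighted isomorphism between posets that contain `K_{1,2}` and that fixes `K_{1,2}`. -/
structure IsStrongIso (f : Q g ≃ Q h) : Prop where
  iso : IsWeightedIso f
  mem : unlabelled (Star 2) ∈ Q g
  fixed : (f ⟨_, mem⟩).1 = unlabelled (Star 2)

theorem IsStrongIso.symm (hf : IsStrongIso f) : IsStrongIso f.symm where
  iso := hf.iso.symm
  mem := hf.fixed ▸ (f ⟨_, hf.mem⟩).2
  fixed := by
    have : (⟨_, hf.fixed ▸ (f ⟨_, hf.mem⟩).2⟩ : Q h) = f ⟨_, hf.mem⟩ := Subtype.ext hf.fixed.symm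
    rw [this, f.symm_apply_apply]

theorem IsStrongIso.adjPairs_eq (hf : IsStrongIso f) (x : Q g) :
    adjPairs (f x).1 = adjPairs x.1 := by
  rw [adjPairs, adjPairs, (hf.iso ⟨_, hf.mem⟩ x).2, hf.fixed]

/-- Connectedness is preserved: a connected graph arises from `K_2` by adding edges, each of
which creates a new pair of adjacent edges. -/
theorem IsStrongIso.conn (hf : IsStrongIso f) (x : Q g) (hx : Conn x.1) : Conn (f x).1 := by
  induction hn : numEdges x.1 using Nat.strong_induction_on generalizing x with
  | _ n ih =>
    have hpos := x.2.2
    by_cases h1 : n = 1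
    · have h2 : unlabelled (K 2) = (f x).1 := by
        refine (K2_edgeLE (f x).2.2).eq_of_numEdges_le (f x).2.1.self ?_
        rw [hf.iso.numEdges_eq, numEdges_K2, hn, h1]
      rw [← h2, conn_unlabelled]
      exact SimpleGraph.connected_top
    · obtain ⟨y, hyx, hy, hye, hya⟩ := hx.exists_edgeLE (by omega)
      have hyQ : y ∈ Q g := ⟨hyx.trans x.2.1, by omega⟩
      refine Conn.of_edgeLE (f x).2.1.self (ih (numEdges y) (by omega) ⟨y, hyQ⟩ hy rfl)
        ((hf.iso _ _).1.1 hyx) ?_ ?_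
      · rwa [hf.iso.numEdges_eq, hf.iso.numEdges_eq]
      · rwa [hf.adjPairs_eq, hf.adjPairs_eq]

theorem connected_T4 : T4.Connected := by
  have h : ∀ v, T4.Reachable v 0 := by
    have h3 : T4.Adj 3 0 := by simp [T4]
    have h4 : T4.Adj 4 3 := by simp [T4]
    intro v
    fin_cases v
    · exact SimpleGraph.Reachable.rfl
    · exact SimpleGraph.Adj.reachable (by simp [T4])
    · exact SimpleGraph.Adj.reachable (by simp [T4])
    · exact h3.reachable
    · exact h4.reachable.trans h3.reachable
  exact ⟨fun x y => (h x).trans (h y).symm⟩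

theorem connected_star (m : ℕ) : (Star m).Connected := by
  have h : ∀ v, (Star m).Reachable v (Sum.inl 0) := by
    rintro (v | v)
    · rw [Subsingleton.elim v 0]
    · exact SimpleGraph.Adj.reachable (by simp)
  exact ⟨fun x y => (h x).trans (h y).symm⟩

/-- Among the connected graphs with four edges and without `T_4` and `K_{1,4}`, only `C_4` has four
pairs of adjacent edges, and it does not contain `K_{1,2} + K_2`. -/
theorem not_edgeLE_of_thin {V W : Type*} [Finite V] [Finite W] {G : SimpleGraph V}
    (hG : G.Connected) (hthin : IsThin G) (he : G.edgeSet.ncard = 4)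
    (ha : edgeSubgraphCount (Star 2) G = 4) {T : SimpleGraph W} (hT : IsEdgeSubgraph T G)
    (heT : T.edgeSet.ncard = 3) (haT : edgeSubgraphCount (Star 2) T = 1) : False := by
  classical
  have := Fintype.ofFinite W
  have hne : G.edgeSet.Nonempty := (Set.ncard_pos (Set.toFinite _)).1 (by omega)
  rcases exists_iso_of_isThin hG hne hthin with
    ⟨n, hn, h, h1, h2⟩ | ⟨n, hn, ⟨φ⟩, h1, h2⟩ | ⟨h, h1, h2⟩ | ⟨h, h1, h2⟩ | ⟨h, h1, h2⟩ |
      ⟨h, h1, h2⟩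
  · omega
  · obtain rfl : n = 4 := by omega
    rw [isEdgeSubgraph_iff] at hT
    obtain ⟨ψ⟩ := (SimpleGraph.isContained_congr_right φ).1 hT.2
    have hdeg : ∀ v, T.degree v ≤ 2 := fun v =>
      (ψ.degree_le v).trans (degree_cycle (by norm_num) _).le
    have h3 := edgeSubgraphCount_star_two_add_card hT.1 hdeg
    have h4 := Fintype.card_le_of_injective ψ ψ.injective
    rw [Fintype.card_fin] at h4
    omega
  all_goals omega

theorem numEdges_and_adjPairs_T4 :
    numEdges (unlabelled T4) = 4 ∧ adjPairs (unlabelled T4) = 4 :=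
  numEdges_and_adjPairs (by decide)

theorem numEdges_and_adjPairs_star_four :
    numEdges (unlabelled (Star 4)) = 4 ∧ adjPairs (unlabelled (Star 4)) = 6 :=
  numEdges_and_adjPairs (by decide)

theorem numEdges_and_adjPairs_star_two_sum_K2 :
    numEdges (unlabelled (Star 2 ⊕g K 2)) = 3 ∧ adjPairs (unlabelled (Star 2 ⊕g K 2)) = 1 :=
  numEdges_and_adjPairs (by decide)

theorem noIsolated_star_two_sum_K2 : NoIsolated (Star 2 ⊕g K 2) := by
  unfold NoIsolated
  decide

theorem star_two_sum_K2_isContained_T4 : (Star 2 ⊕g K 2).IsContained T4 := by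
  refine ⟨⟨⟨Sum.elim (Sum.elim (fun _ => 0) ![1, 2]) ![3, 4], ?_⟩, ?_⟩⟩
  · intro a b
    revert a b
    decide
  · unfold Function.Injective
    decide

/-- A preimage of `T_4` would be a connected thin graph with four edges, four pairs of adjacent
edges and a subgraph `K_{1,2} + K_2`; a preimage of `K_{1,4}` would have four edges and six pairs of
adjacent edges. -/
theorem IsStrongIso.thin (hf : IsStrongIso f) (hg : Thin g) : Thin h := by
  constructor
  · intro hle
    have hT : unlabelled T4 ∈ Q h := ⟨hle, by rw [numEdges_and_adjPairs_T4.1]; norm_num⟩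
    have hzT : EdgeLE (unlabelled (Star 2 ⊕g K 2)) (unlabelled T4) := by
      rw [edgeLE_unlabelled, isEdgeSubgraph_iff]
      exact ⟨noIsolated_star_two_sum_K2, star_two_sum_K2_isContained_T4⟩
    have hz : unlabelled (Star 2 ⊕g K 2) ∈ Q h :=
      ⟨hzT.trans hle, by rw [numEdges_and_adjPairs_star_two_sum_K2.1]; norm_num⟩
    have h1 : Conn (f.symm ⟨_, hT⟩).1 := hf.symm.conn _ (conn_unlabelled.2 connected_T4)
    have h2 : Thin (f.symm ⟨_, hT⟩).1 := hg.of_edgeLE (f.symm _).2.1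
    have h3 := (hf.symm.iso.numEdges_eq ⟨_, hT⟩).trans numEdges_and_adjPairs_T4.1
    have h4 := (hf.symm.adjPairs_eq ⟨_, hT⟩).trans numEdges_and_adjPairs_T4.2
    have h5 := (hf.symm.iso.numEdges_eq ⟨_, hz⟩).trans numEdges_and_adjPairs_star_two_sum_K2.1
    have h6 := (hf.symm.adjPairs_eq ⟨_, hz⟩).trans numEdges_and_adjPairs_star_two_sum_K2.2
    have h7 : EdgeLE (f.symm ⟨_, hz⟩).1 (f.symm ⟨_, hT⟩).1 := (hf.symm.iso _ _).1.1 hzT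
    generalize (f.symm ⟨_, hT⟩).1 = x at *
    generalize (f.symm ⟨_, hz⟩).1 = z at *
    obtain ⟨_, A, rfl⟩ := exists_rep x
    obtain ⟨_, B, rfl⟩ := exists_rep z
    rw [numEdges_unlabelled] at h3 h5
    rw [adjPairs_unlabelled] at h4 h6
    exact not_edgeLE_of_thin (conn_unlabelled.1 h1) (thin_unlabelled.1 h2) h3 h4
      (edgeLE_unlabelled.1 h7) h5 h6
  · intro hle
    have hS : unlabelled (Star 4) ∈ Q h :=
      ⟨hle, by rw [numEdges_and_adjPairs_star_four.1]; norm_num⟩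
    have h1 : Conn (f.symm ⟨_, hS⟩).1 := hf.symm.conn _ (conn_unlabelled.2 (connected_star 4))
    have h2 : Thin (f.symm ⟨_, hS⟩).1 := hg.of_edgeLE (f.symm _).2.1
    have h3 := (hf.symm.iso.numEdges_eq ⟨_, hS⟩).trans numEdges_and_adjPairs_star_four.1
    have h4 := (hf.symm.adjPairs_eq ⟨_, hS⟩).trans numEdges_and_adjPairs_star_four.2
    generalize (f.symm ⟨_, hS⟩).1 = x at *
    obtain ⟨_, A, rfl⟩ := exists_rep x
    have h5 : A.edgeSet.Nonempty := edgeSet_nonempty_of_numEdges (by omega)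
    rw [numEdges_unlabelled] at h3
    rw [adjPairs_unlabelled] at h4
    rcases exists_iso_of_isThin (conn_unlabelled.1 h1) h5 (thin_unlabelled.1 h2) with
      ⟨n, hn, h, h1, h2⟩ | ⟨n, hn, h, h1, h2⟩ | ⟨h, h1, h2⟩ | ⟨h, h1, h2⟩ | ⟨h, h1, h2⟩ |
        ⟨h, h1, h2⟩ <;> omega

/-- Connected graphs are fixed, except that `K_3` and `K_{1,3}` may be confused. -/
theorem IsStrongIso.eq_or (hf : IsStrongIso f) (hg : Thin g) (x : Q g) (hx : Conn x.1) :
    (f x).1 = x.1 ∨ ((x.1 = unlabelled (K 3) ∨ x.1 = unlabelled (Star 3)) ∧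
      ((f x).1 = unlabelled (K 3) ∨ (f x).1 = unlabelled (Star 3))) := by
  rcases eq_or_of_thin hx (hf.conn x hx) x.2.2 (hg.of_edgeLE x.2.1)
    ((hf.thin hg).of_edgeLE (f x).2.1) (hf.iso.numEdges_eq x).symm (hf.adjPairs_eq x).symm with
    h1 | h1
  · exact Or.inl h1.symm
  · exact Or.inr h1

/-- Graphs without isolated vertices are the greatest elements of their posets. -/
theorem IsWeightedIso.apply_top (hf : IsWeightedIso f) (hg : g ∈ Q g) (hh : h ∈ Q h) :
    (f ⟨g, hg⟩).1 = h := by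
  have h1 : EdgeLE (f (f.symm ⟨h, hh⟩)).1 (f ⟨g, hg⟩).1 := (hf _ _).1.1 (f.symm ⟨h, hh⟩).2.1
  rw [f.apply_symm_apply] at h1
  exact (h1.eq_of_numEdges_le (f ⟨g, hg⟩).2.1.self (f ⟨g, hg⟩).2.1.numEdges_le).symm

theorem IsWeightedIso.q_top (hf : IsWeightedIso f) (hg : g ∈ Q g) (hh : h ∈ Q h) (x : Q g) :
    q (f x).1 h = q x.1 g := by
  have := (hf x ⟨g, hg⟩).2
  rw [hf.apply_top hg hh] at this
  exact this.symm

theorem IsStrongIso.q_eq_of_ne (hf : IsStrongIso f) (hg : Thin g) (hgQ : g ∈ Q g) (hhQ : h ∈ Q h)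
    {t : UnlabelledGraph} (ht : Conn t) (hte : 0 < numEdges t) (h3 : t ≠ unlabelled (K 3))
    (hs : t ≠ unlabelled (Star 3)) : q t g = q t h := by
  by_cases htg : EdgeLE t g
  · have htQ : t ∈ Q g := ⟨htg, hte⟩
    rcases hf.eq_or hg ⟨t, htQ⟩ ht with h1 | h1
    · have := hf.iso.q_top hgQ hhQ ⟨t, htQ⟩
      rw [h1] at this
      exact this.symm
    · rcases h1.1 with h1 | h1
      · exact absurd h1 h3
      · exact absurd h1 hs
  · rw [q_eq_zero_iff.2 htg, eq_comm, q_eq_zero_iff]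
    intro hth
    have htQ : t ∈ Q h := ⟨hth, hte⟩
    rcases hf.symm.eq_or (hf.thin hg) ⟨t, htQ⟩ ht with h1 | h1
    · have h2 := (f.symm ⟨t, htQ⟩).2.1
      rw [h1] at h2
      exact htg h2
    · rcases h1.1 with h1 | h1
      · exact absurd h1 h3
      · exact absurd h1 hs

/-- If `K_3` and `K_{1,3}` occur equally often in one graph, confusing them has no effect. -/
theorem IsStrongIso.q_eq (hf : IsStrongIso f) (hg : Thin g) (hgQ : g ∈ Q g) (hhQ : h ∈ Q h)
    (hbal : q (unlabelled (K 3)) g = q (unlabelled (Star 3)) g)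
    {t : UnlabelledGraph} (ht : Conn t) (hte : 0 < numEdges t) : q t g = q t h := by
  have hKe : 0 < numEdges (unlabelled (K 3)) := by rw [numEdges_and_adjPairs_K3.1]; norm_num
  have hSe : 0 < numEdges (unlabelled (Star 3)) := by
    rw [numEdges_and_adjPairs_star_three.1]; norm_num
  have hKc : Conn (unlabelled (K 3)) := conn_unlabelled.2 SimpleGraph.connected_top
  have hSc : Conn (unlabelled (Star 3)) := conn_unlabelled.2 (connected_star 3)
  have key : ∀ t, t = unlabelled (K 3) ∨ t = unlabelled (Star 3) → q t g = q t h := by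
    intro t ht
    have hte : 0 < numEdges t := by rcases ht with rfl | rfl <;> assumption
    have htc : Conn t := by rcases ht with rfl | rfl <;> assumption
    have hqt : ∀ s, s = unlabelled (K 3) ∨ s = unlabelled (Star 3) → q s g = q t g := by
      rintro s (rfl | rfl) <;> rcases ht with rfl | rfl <;> simp [hbal]
    by_cases hth : EdgeLE t h
    · have htQ : t ∈ Q h := ⟨hth, hte⟩
      have h1 := hf.symm.iso.q_top hhQ hgQ ⟨t, htQ⟩
      rcases hf.symm.eq_or (hf.thin hg) ⟨t, htQ⟩ htc with h2 | ⟨-, h2⟩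
      · rwa [h2] at h1
      · rwa [hqt _ h2] at h1
    · rw [q_eq_zero_iff.2 hth, q_eq_zero_iff]
      intro htg
      have htQ : t ∈ Q g := ⟨htg, hte⟩
      -- Both `K_3` and `K_{1,3}` lie in `Q g`, so one of them is sent to `t`.
      have hmem : ∀ s, s = unlabelled (K 3) ∨ s = unlabelled (Star 3) → s ∈ Q g := by
        intro s hs
        refine ⟨q_ne_zero_iff.1 ?_, by rcases hs with rfl | rfl <;> assumption⟩
        rw [hqt s hs]
        exact q_ne_zero_iff.2 htg
      have himg : ∀ s (hs : s = unlabelled (K 3) ∨ s = unlabelled (Star 3)),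
          ((f ⟨s, hmem s hs⟩).1 = unlabelled (K 3) ∨ (f ⟨s, hmem s hs⟩).1 = unlabelled (Star 3)) ∧
            (f ⟨s, hmem s hs⟩).1 ≠ t := by
        intro s hs
        refine ⟨?_, fun h => hth (h ▸ (f ⟨s, hmem s hs⟩).2.1)⟩
        have hsc : Conn s := by rcases hs with rfl | rfl <;> assumption
        rcases hf.eq_or hg ⟨s, hmem s hs⟩ hsc with h2 | ⟨-, h2⟩
        · rwa [h2]
        · exact h2
      have hK := himg _ (Or.inl rfl)
      have hS := himg _ (Or.inr rfl)
      refine K3_ne_star_three (Subtype.ext_iff.1 (f.injective (Subtype.ext ?_) :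
        (⟨_, hmem _ (Or.inl rfl)⟩ : Q g) = ⟨_, hmem _ (Or.inr rfl)⟩))
      rcases ht with rfl | rfl
      · rw [hK.1.resolve_left hK.2, hS.1.resolve_left hS.2]
      · rw [hK.1.resolve_right hK.2, hS.1.resolve_right hS.2]
  by_cases h1 : t = unlabelled (K 3) ∨ t = unlabelled (Star 3)
  · exact key t h1
  · push Not at h1
    exact hf.q_eq_of_ne hg hgQ hhQ ht hte h1.1 h1.2

end Iso
end UnlabelledGraph

/-! ### Graphs outside `𝒩` have as many triangles as claws -/

section Decomposition

variable {V W U : Type*}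

/-- The vertices whose component is isomorphic to `T` induce a disjoint union of copies of `T`. -/
theorem induce_iso_copies [Finite V] [Finite W] (G : SimpleGraph V) (T : SimpleGraph W) :
    Nonempty (G.induce {v | unlabelled (G.connectedComponentMk v).toSimpleGraph = unlabelled T} ≃g
      copies (Nat.card {c : G.ConnectedComponent // unlabelled c.toSimpleGraph = unlabelled T})
        T) := by
  let I := {c : G.ConnectedComponent // unlabelled c.toSimpleGraph = unlabelled T}
  let e : Fin (Nat.card I) ≃ I := (Finite.equivFin I).symm
  let θ : ∀ c : I, c.1.toSimpleGraph ≃g T := fun c => ((unlabelled_eq_iff _ _).1 c.2).some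
  let f : Fin (Nat.card I) × W → V := fun p => ((θ (e p.1)).symm p.2).1
  have hmk : ∀ p, G.connectedComponentMk (f p) = (e p.1).1 := fun p => ((θ (e p.1)).symm p.2).2
  have hf : ∀ p, f p ∈ {v | unlabelled (G.connectedComponentMk v).toSimpleGraph =
      unlabelled T} := by
    intro p
    rw [Set.mem_ofPred_eq, hmk]
    exact (e p.1).2
  have hfst : ∀ p p', G.connectedComponentMk (f p) = G.connectedComponentMk (f p') →
      p.1 = p'.1 := by
    intro p p' h
    rw [hmk, hmk] at h
    exact e.injective (Subtype.ext h)
  have hbij : Function.Bijective fun p => (⟨f p, hf p⟩ :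
      {v | unlabelled (G.connectedComponentMk v).toSimpleGraph = unlabelled T}) := by
    constructor
    · rintro ⟨i, w⟩ ⟨j, w'⟩ h
      have h1 : f (i, w) = f (j, w') := Subtype.ext_iff.1 h
      obtain rfl : i = j := hfst _ _ (congrArg _ h1)
      have h2 := (θ (e i)).symm.injective (Subtype.ext h1)
      exact Prod.ext rfl h2
    · rintro ⟨v, hv⟩
      let c : I := ⟨G.connectedComponentMk v, hv⟩
      have key : ∀ d : I, d = c → ∀ hd : v ∈ d.1.supp,
          ((θ d).symm (θ d ⟨v, hd⟩)).1 = v := by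
        intro d _ hd
        rw [RelIso.symm_apply_apply]
      have hd : v ∈ (e (e.symm c)).1.supp := by
        rw [e.apply_symm_apply]
        rfl
      exact ⟨(e.symm c, θ (e (e.symm c)) ⟨v, hd⟩),
        Subtype.ext (key _ (e.apply_symm_apply c) hd)⟩
  refine ⟨SimpleGraph.Iso.symm ⟨Equiv.ofBijective _ hbij, ?_⟩⟩
  rintro ⟨i, w⟩ ⟨j, w'⟩
  change G.Adj (f (i, w)) (f (j, w')) ↔ _
  rw [SimpleGraph.boxProd_adj]
  simp only [SimpleGraph.bot_adj, false_and, false_or]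
  constructor
  · intro h
    obtain rfl : i = j :=
      hfst _ _ (SimpleGraph.ConnectedComponent.connectedComponentMk_eq_of_adj h)
    exact ⟨(θ (e i)).symm.map_rel_iff.1 h, rfl⟩
  · rintro ⟨h, rfl⟩
    exact (θ (e i)).symm.map_rel_iff.2 h

/-- A graph is the disjoint union of the parts of a partition into three parts without edges
between them. -/
theorem iso_sum_of_partition {G : SimpleGraph V} {A B D : Set V}
    (hcover : ∀ v, v ∈ A ∨ v ∈ B ∨ v ∈ D) (hAB : ∀ v ∈ A, v ∉ B) (hAD : ∀ v ∈ A, v ∉ D)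
    (hBD : ∀ v ∈ B, v ∉ D) (hA : ∀ v w, G.Adj v w → (v ∈ A ↔ w ∈ A))
    (hB : ∀ v w, G.Adj v w → (v ∈ B ↔ w ∈ B)) :
    Nonempty (G ≃g G.induce A ⊕g G.induce B ⊕g G.induce D) := by
  let f : (A ⊕ B) ⊕ D → V := Sum.elim (Sum.elim Subtype.val Subtype.val) Subtype.val
  have hbij : Function.Bijective f := by
    constructor
    · rintro ((a | a) | a) ((b | b) | b) h
      · rw [Subtype.ext (show a.1 = b.1 from h)]
      · exact absurd b.2 (hAB b.1 ((show a.1 = b.1 from h) ▸ a.2))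
      · exact absurd b.2 (hAD b.1 ((show a.1 = b.1 from h) ▸ a.2))
      · exact absurd a.2 (hAB a.1 ((show a.1 = b.1 from h).symm ▸ b.2))
      · rw [Subtype.ext (show a.1 = b.1 from h)]
      · exact absurd b.2 (hBD b.1 ((show a.1 = b.1 from h) ▸ a.2))
      · exact absurd a.2 (hAD a.1 ((show a.1 = b.1 from h).symm ▸ b.2))
      · exact absurd a.2 (hBD a.1 ((show a.1 = b.1 from h).symm ▸ b.2))
      · rw [Subtype.ext (show a.1 = b.1 from h)]
    · intro v
      rcases hcover v with h | h | h
      · exact ⟨Sum.inl (Sum.inl ⟨v, h⟩), rfl⟩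
      · exact ⟨Sum.inl (Sum.inr ⟨v, h⟩), rfl⟩
      · exact ⟨Sum.inr ⟨v, h⟩, rfl⟩
  refine ⟨SimpleGraph.Iso.symm ⟨Equiv.ofBijective f hbij, ?_⟩⟩
  intro x y
  change G.Adj (f x) (f y) ↔ _
  rcases x with ((a | a) | a) <;> rcases y with ((b | b) | b)
  · exact Iff.rfl
  · exact iff_of_false (fun h => hAB b.1 ((hA _ _ h).1 a.2) b.2) (fun h => by cases h)
  · exact iff_of_false (fun h => hAD b.1 ((hA _ _ h).1 a.2) b.2) (fun h => by cases h)
  · exact iff_of_false (fun h => hAB a.1 ((hA _ _ h).2 b.2) a.2) (fun h => by cases h)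
  · exact Iff.rfl
  · exact iff_of_false (fun h => hBD b.1 ((hB _ _ h).1 a.2) b.2) (fun h => by cases h)
  · exact iff_of_false (fun h => hAD a.1 ((hA _ _ h).2 b.2) a.2) (fun h => by cases h)
  · exact iff_of_false (fun h => hBD a.1 ((hB _ _ h).2 b.2) a.2) (fun h => by cases h)
  · exact Iff.rfl

/-- An embedding whose range is closed under adjacency preserves components. -/
theorem component_iso_of_closed_range {F : SimpleGraph U} {G : SimpleGraph V} (ι : F ↪g G)
    (hcl : ∀ x y, G.Adj (ι x) y → y ∈ Set.range ι) (v : U) :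
    Nonempty ((F.connectedComponentMk v).toSimpleGraph ≃g
      (G.connectedComponentMk (ι v)).toSimpleGraph) := by
  have hto : ∀ x, F.connectedComponentMk x = F.connectedComponentMk v →
      G.connectedComponentMk (ι x) = G.connectedComponentMk (ι v) := fun x hx =>
    SimpleGraph.ConnectedComponent.sound
      ((SimpleGraph.ConnectedComponent.exact hx).map ι.toHom)
  have hwalk : ∀ y z, G.Walk y z → ∀ x, F.Reachable x v → y = ι x →
      ∃ x', F.Reachable x' v ∧ ι x' = z := by
    intro y z p
    induction p with
    | nil => exact fun x hx hy => ⟨x, hx, hy.symm⟩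
    | cons h _ ih =>
      rintro x hx rfl
      obtain ⟨x', rfl⟩ := hcl _ _ h
      exact ih x' ((ι.map_rel_iff.1 h).symm.reachable.trans hx) rfl
  refine ⟨⟨Equiv.ofBijective (fun x => ⟨ι x.1, hto x.1 x.2⟩) ⟨?_, ?_⟩, ?_⟩⟩
  · intro a b h
    exact Subtype.ext (ι.injective (Subtype.ext_iff.1 h))
  · rintro ⟨z, hz⟩
    obtain ⟨p⟩ := (SimpleGraph.ConnectedComponent.exact hz).symm
    obtain ⟨x, hx, rfl⟩ := hwalk _ _ p v SimpleGraph.Reachable.rfl rfl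
    exact ⟨⟨x, SimpleGraph.ConnectedComponent.sound hx⟩, rfl⟩
  · intro a b
    exact ι.map_rel_iff

theorem mem_X_of_isThin [Finite V] {G : SimpleGraph V} (hG : G.Connected)
    (he : G.edgeSet.Nonempty) (hthin : IsThin G) (h3 : unlabelled G ≠ unlabelled (K 3))
    (hs : unlabelled G ≠ unlabelled (Star 3)) : unlabelled G ∈ X := by
  rcases exists_iso_of_isThin hG he hthin with
    ⟨n, hn, ⟨φ⟩, -⟩ | ⟨n, hn, ⟨φ⟩, -⟩ | ⟨⟨φ⟩, -⟩ | ⟨⟨φ⟩, -⟩ | ⟨⟨φ⟩, -⟩ | ⟨⟨⟨φ⟩⟩ | ⟨⟨φ⟩⟩, -⟩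
  · exact Or.inl (Or.inl ⟨n, hn, UnlabelledGraph.unlabelled_congr φ⟩)
  · exact Or.inl (Or.inr ⟨n, hn, UnlabelledGraph.unlabelled_congr φ⟩)
  · exact Or.inr (Or.inl (UnlabelledGraph.unlabelled_congr φ))
  · exact Or.inr (Or.inr (Or.inl (UnlabelledGraph.unlabelled_congr φ)))
  · exact Or.inr (Or.inr (Or.inr (UnlabelledGraph.unlabelled_congr φ)))
  · exact absurd (UnlabelledGraph.unlabelled_congr φ) h3
  · exact absurd (UnlabelledGraph.unlabelled_congr φ) hs

/-- A graph without isolated vertices, `T_4` and `K_{1,4}` has the form `r K_3 + s K_{1,3} + F`. -/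
theorem exists_unlabelled_eq_sum [Finite V] {G : SimpleGraph V} (hG : NoIsolated G)
    (hthin : IsThin G) : ∃ (n : ℕ) (F : SimpleGraph (Fin n)), ComponentsInX F ∧
      unlabelled G = unlabelled
        (copies (Nat.card {c : G.ConnectedComponent //
            unlabelled c.toSimpleGraph = unlabelled (K 3)}) (K 3) ⊕g
          copies (Nat.card {c : G.ConnectedComponent //
            unlabelled c.toSimpleGraph = unlabelled (Star 3)}) (Star 3) ⊕g F) := by
  let τ : V → UnlabelledGraph := fun v => unlabelled (G.connectedComponentMk v).toSimpleGraph
  have hτ : ∀ v w, G.Adj v w → τ v = τ w := by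
    intro v w h
    have := SimpleGraph.ConnectedComponent.connectedComponentMk_eq_of_adj h
    simp only [τ]
    rw [this]
  let A : Set V := {v | τ v = unlabelled (K 3)}
  let B : Set V := {v | τ v = unlabelled (Star 3)}
  let D : Set V := {v | τ v ≠ unlabelled (K 3) ∧ τ v ≠ unlabelled (Star 3)}
  obtain ⟨φ⟩ : Nonempty (G ≃g G.induce A ⊕g G.induce B ⊕g G.induce D) := by
    refine iso_sum_of_partition ?_ ?_ ?_ ?_ ?_ ?_
    · intro v
      simp only [A, B, D, Set.mem_ofPred_eq]
      tauto
    · intro v h1 h2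
      exact UnlabelledGraph.K3_ne_star_three ((show τ v = _ from h1).symm.trans h2)
    · intro v h1 h2
      exact h2.1 h1
    · intro v h1 h2
      exact h2.2 h1
    · intro v w h
      simp only [A, Set.mem_ofPred_eq, hτ v w h]
    · intro v w h
      simp only [B, Set.mem_ofPred_eq, hτ v w h]
  obtain ⟨n, F, hF⟩ := UnlabelledGraph.exists_rep (unlabelled (G.induce D))
  obtain ⟨ψ⟩ := (unlabelled_eq_iff _ _).1 hF
  obtain ⟨α⟩ := induce_iso_copies G (K 3)
  obtain ⟨β⟩ := induce_iso_copies G (Star 3)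
  refine ⟨n, F, ?_, UnlabelledGraph.unlabelled_congr
    (φ.trans (SimpleGraph.Iso.sumCongr (SimpleGraph.Iso.sumCongr α β) ψ))⟩
  intro c
  obtain ⟨v, rfl⟩ := c.exists_rep
  let ι : F ↪g G := (SimpleGraph.Embedding.induce D).comp ψ.symm.toEmbedding
  have hι : ∀ x, ι x = (ψ.symm x).1 := fun _ => rfl
  have hcl : ∀ x y, G.Adj (ι x) y → y ∈ Set.range ι := by
    intro x y h
    have hx : ι x ∈ D := (ψ.symm x).2
    have hy : y ∈ D := by
      simp only [D, Set.mem_ofPred_eq] at hx ⊢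
      rwa [← hτ _ _ h]
    exact ⟨ψ ⟨y, hy⟩, by rw [hι, ψ.symm_apply_apply]⟩
  obtain ⟨χ⟩ := component_iso_of_closed_range ι hcl v
  have hv : ι v ∈ D := (ψ.symm v).2
  have heq := UnlabelledGraph.unlabelled_congr χ
  refine mem_X_of_isThin (SimpleGraph.ConnectedComponent.connected_toSimpleGraph _) ?_ ?_ ?_ ?_
  · obtain ⟨y, hy⟩ := hG (ι v)
    obtain ⟨w, rfl⟩ := hcl v y hy
    have hvw : F.Adj v w := ι.map_rel_iff.1 hy
    exact ⟨s(⟨v, rfl⟩, ⟨w, (SimpleGraph.ConnectedComponent.connectedComponentMk_eq_of_adj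
      hvw).symm⟩), hvw⟩
  · exact hthin.of_isContained (((SimpleGraph.Embedding.induce _).isContained).trans
      ι.isContained)
  · exact fun h => hv.1 (heq.symm.trans h)
  · exact fun h => hv.2 (heq.symm.trans h)

/-- The surplus of triangles over claws is the surplus of components `K_3` over components
`K_{1,3}`. -/
theorem edgeSubgraphCount_K3_sub_star [Finite V] {G : SimpleGraph V} (hG : NoIsolated G)
    (hthin : IsThin G) :
    edgeSubgraphCount (K 3) G - edgeSubgraphCount (Star 3) G =
      (Nat.card {c : G.ConnectedComponent // unlabelled c.toSimpleGraph = unlabelled (K 3)} : ℤ) -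
        Nat.card {c : G.ConnectedComponent //
          unlabelled c.toSimpleGraph = unlabelled (Star 3)} := by
  classical
  have := Fintype.ofFinite G.ConnectedComponent
  have hKe : (K 3).edgeSet.Nonempty := ⟨s(0, 1), by simp⟩
  have hSe : (Star 3).edgeSet.Nonempty := ⟨s(Sum.inl 0, Sum.inr 0), by simp⟩
  have hKS : edgeSubgraphCount (K 3) (Star 3) = 0 := by
    rw [edgeSubgraphCount_K _ (by norm_num)]
    decide
  have hSK : edgeSubgraphCount (Star 3) (K 3) = 0 := by
    rw [edgeSubgraphCount_star _ (by norm_num)]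
    decide
  rw [edgeSubgraphCount_eq_sum_components G SimpleGraph.connected_top hKe,
    edgeSubgraphCount_eq_sum_components G (UnlabelledGraph.connected_star 3) hSe,
    ← Finset.sum_sub_distrib, Nat.card_eq_fintype_card, Nat.card_eq_fintype_card,
    Fintype.card_subtype, Fintype.card_subtype, Finset.card_filter, Finset.card_filter]
  push_cast
  rw [← Finset.sum_sub_distrib]
  refine Finset.sum_congr rfl fun c _ => ?_
  by_cases h1 : unlabelled c.toSimpleGraph = unlabelled (K 3)
  · obtain ⟨φ⟩ := (unlabelled_eq_iff _ _).1 h1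
    rw [if_pos h1, if_neg fun h2 => UnlabelledGraph.K3_ne_star_three (h1.symm.trans h2),
      edgeSubgraphCount_congr SimpleGraph.Iso.refl φ (H := Star 3), hSK,
      edgeSubgraphCount_self ((noIsolated_K (by norm_num)).congr φ.symm) φ]
  · by_cases h2 : unlabelled c.toSimpleGraph = unlabelled (Star 3)
    · obtain ⟨φ⟩ := (unlabelled_eq_iff _ _).1 h2
      rw [if_neg h1, if_pos h2,
        edgeSubgraphCount_congr SimpleGraph.Iso.refl φ (H := K 3), hKS,
        edgeSubgraphCount_self ((noIsolated_star (by norm_num)).congr φ.symm) φ]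
    · rw [if_neg h1, if_neg h2, sub_self, sub_eq_zero]
      refine edgeSubgraphCount_K3_eq_star_of_isThin c.connected_toSimpleGraph ?_
        (hthin.of_isContained (SimpleGraph.Embedding.induce _).isContained)
        (fun h => h1 ((unlabelled_eq_iff _ _).2 h)) (fun h => h2 ((unlabelled_eq_iff _ _).2 h))
      obtain ⟨n, T, hT, -, e, he⟩ := exists_connected_rep_component hG c
      obtain ⟨φ⟩ := (unlabelled_eq_iff _ _).1 hT
      induction e with
      | _ a b => exact ⟨s(φ.symm a, φ.symm b), φ.symm.map_rel_iff.2 he⟩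

end Decomposition

/-- Isolated vertices do not affect the edge-subgraphs. -/
theorem Q_induce_support {W : Type*} [Finite W] (H : SimpleGraph W) :
    UnlabelledGraph.Q (unlabelled (H.induce H.support)) = UnlabelledGraph.Q (unlabelled H) := by
  ext x
  obtain ⟨n, T, rfl⟩ := UnlabelledGraph.exists_rep x
  refine and_congr_left fun _ => ?_
  rw [UnlabelledGraph.edgeLE_unlabelled, UnlabelledGraph.edgeLE_unlabelled, isEdgeSubgraph_iff,
    isEdgeSubgraph_iff]
  refine and_congr_right fun hT => ⟨fun h => h.trans (SimpleGraph.Embedding.induce _).isContained,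
    ?_⟩
  rintro ⟨φ⟩
  refine ⟨⟨⟨fun v => ⟨φ v, ?_⟩, fun {a b} h => φ.toHom.map_rel h⟩, ?_⟩⟩
  · obtain ⟨w, hw⟩ := hT v
    exact ⟨φ w, φ.toHom.map_rel hw⟩
  · intro a b h
    exact φ.injective (Subtype.ext_iff.1 h)

theorem noIsolated_induce_support {W : Type*} (H : SimpleGraph W) :
    NoIsolated (H.induce H.support) := by
  rintro ⟨v, w, h⟩
  exact ⟨⟨w, v, h.symm⟩, h⟩

theorem noIsolated_star_two_sum_copies : NoIsolated (Star 2 ⊕g copies 2 (K 2)) := by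
  unfold NoIsolated
  decide

end EdgeSubgraphPoset

open EdgeSubgraphPoset EdgeSubgraphPoset.UnlabelledGraph in
/-- A finite graph without isolated vertices that is not in `𝒩`, has maximum degree at most 3,
contains `K_{1,2} + 2K_2` and does not contain `T_4` is `Q`-reconstructible. -/
theorem mainTheorem4 {V : Type*} [Fintype V] (G : SimpleGraph V) [DecidableRel G.Adj]
    (hiso : ∀ v : V, ∃ w : V, G.Adj v w)
    (hN : EdgeSubgraphPoset.unlabelled G ∉ EdgeSubgraphPoset.N)
    (hdeg : G.maxDegree ≤ 3)
    (hcontains : (EdgeSubgraphPoset.Star 2 ⊕g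
      EdgeSubgraphPoset.copies 2 (EdgeSubgraphPoset.K 2)).IsContained G)
    (hT4 : ¬ EdgeSubgraphPoset.T4.IsContained G) :
    EdgeSubgraphPoset.QReconstructible G := by
  intro W _ H hGH
  have hthin : IsThin G := by
    refine ⟨hT4, fun h => ?_⟩
    obtain ⟨v, hv⟩ := (star_isContained_iff (by norm_num)).1 h
    have := G.degree_le_maxDegree v
    omega
  have hz : unlabelled (Star 2 ⊕g copies 2 (K 2)) ∈ Q (unlabelled G) := by
    refine ⟨?_, by rw [numEdges_and_adjPairs_star_two_sum.1]; norm_num⟩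
    rw [edgeLE_unlabelled, isEdgeSubgraph_iff]
    exact ⟨noIsolated_star_two_sum_copies, hcontains⟩
  have hs : unlabelled (Star 2) ∈ Q (unlabelled G) := by
    refine ⟨?_, by rw [numEdges_and_adjPairs_star_two.1]; norm_num⟩
    rw [edgeLE_unlabelled, isEdgeSubgraph_iff]
    exact ⟨noIsolated_star (by norm_num),
      SimpleGraph.IsContained.trans SimpleGraph.Embedding.sumInl.isContained hcontains⟩
  have hge : 4 ≤ numEdges (unlabelled G) := by
    rw [← numEdges_and_adjPairs_star_two_sum.1]
    exact hz.1.numEdges_le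
  have hgQ : unlabelled G ∈ Q (unlabelled G) := ⟨edgeLE_self_unlabelled.2 hiso, by omega⟩
  have hbal : q (unlabelled (K 3)) (unlabelled G) = q (unlabelled (Star 3)) (unlabelled G) := by
    rw [q_unlabelled, q_unlabelled, ← sub_eq_zero, edgeSubgraphCount_K3_sub_star hiso hthin,
      sub_eq_zero, Nat.cast_inj]
    by_contra hrs
    obtain ⟨n, F, hF, hGF⟩ := exists_unlabelled_eq_sum hiso hthin
    refine hN (Or.inr ⟨⟨_, _, hrs, n, F, hF, hGF⟩, ?_⟩)
    rintro (h | h)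
    · rw [h, numEdges_and_adjPairs_K3.1] at hge
      omega
    · rw [Set.mem_singleton_iff.1 h, numEdges_and_adjPairs_star_three.1] at hge
      omega
  obtain ⟨f, hf⟩ : ∃ f : Q (unlabelled G) ≃ Q (unlabelled (H.induce H.support)),
      IsWeightedIso f := by
    obtain ⟨f, hf⟩ := hGH
    exact ⟨f.trans (Equiv.setCongr (Q_induce_support H).symm), fun x y => hf x y⟩
  have hstrong : IsStrongIso f := ⟨hf, hs, hf.star_two_eq hz hs⟩
  have hhQ : unlabelled (H.induce H.support) ∈ Q (unlabelled (H.induce H.support)) :=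
    ⟨edgeLE_self_unlabelled.2 (noIsolated_induce_support H),
      (f ⟨_, hs⟩).2.2.trans_le (f ⟨_, hs⟩).2.1.numEdges_le⟩
  obtain ⟨φ⟩ : Nonempty (G ≃g H.induce H.support) := by
    refine iso_of_edgeSubgraphCount_connected hiso (noIsolated_induce_support H)
      fun n T hT he => ?_
    rw [← q_unlabelled, ← q_unlabelled]
    refine hstrong.q_eq (thin_unlabelled.2 hthin) hgQ hhQ hbal (conn_unlabelled.2 hT) ?_
    rw [numEdges_unlabelled]
    exact (Set.ncard_pos (Set.toFinite _)).2 he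
  have hsupp : G.support = Set.univ := Set.eq_univ_of_forall hiso
  rw [hsupp]
  exact ⟨(SimpleGraph.induceUnivIso G).trans φ⟩
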